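/- Let $N\cong\mathbf Z^d$ be a lattice with dual lattice $M$, and let $\rho\subset N_{\mathbf R}$ be a rational polyhedral cone which is strictly convex and of dimension $d$. Let $\rho^\vee\subset M_{\mathbf R}$ be its dual cone and write $u\le_\rho u'$ if $u'-u\in\rho^\vee$. For a lattice $\Lambda\subset M_{\mathbf Q}$ let $\mathbf C\{\rho^\vee\cap\Lambda\}$ be the ring of convergent power series with exponents in $\rho^\vee\cap\Lambda$; "unit" means a series with non-zero constant term. A monic polynomial over $\mathbf C\{\rho^\vee\cap M\}$ is quasi-ordinary if its discriminant is $X^\eta\cdot$unit. Let $f\in\mathbf C\{\rho^\vee\cap M\}[Y]$ be an irreducible monic quasi-ordinary polynomial of degree $n$ whose non-leading coefficients have zero constant term, let $\zeta\in\mathbf C\{\rho^\vee\cap\frac1nM\}$ be a root of $f$, and let $R=\mathbf C\{\rho^\vee\cap M\}[\zeta]$ be the analytic algebra of the germ $S$ defined by $f$. Let $\lambda_1<_\rho\dots<_\rho\lambda_g$, with $g\ge1$, be the characteristic exponents of $f$, i.e. the exponents $\lambda$ with $\zeta'-\zeta''=X^{\lambda}\cdot$unit for two different roots $\zeta',\zeta''$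 of $f$ among the series with exponents in $\rho^\vee\cap\frac1mM$, $m\ge1$; put $\lambda_{g+1}=+\infty$. Let $M_0=M$, $M_j=M_{j-1}+\mathbf Z\lambda_j$, $n_0=1$, $n_j=\#M_j/M_{j-1}$, $\gamma_1=\lambda_1$ and $\gamma_{j+1}=n_j\gamma_j+\lambda_{j+1}-\lambda_j$. Let $q_0,\dots,q_g$ be a complete set of semi-roots of $f$: $q_j$ is a non-zero constant times an irreducible monic quasi-ordinary polynomial $p_j$ over $\mathbf C\{\rho^\vee\cap M\}$ of degree $n_0\cdots n_j$ having order of coincidence $\lambda_{j+1}$ with $f$ (for $j<g$ this means that $p_jf$ is quasi-ordinary and that $\lambda_{j+1}$ is the largest exponent $\lambda$ such that $\zeta'-\zeta''=X^\lambda\cdot$unit for a root $\zeta'$ of $p_j$ and a root $\zeta''$ of $f$; for $j=g$ it means $p_g=f$), the constants being such that for $j<g$ the coefficient of $X^{\gamma_{j+1}}$ in $q_j(\zeta)$ is $1$. Define the weight of a monomial $X^\alpha U_1^{v_1}\cdots U_g^{v_g}$ to be $\alpha+v_1\gamma_1+\dots+v_g\gamma_g$. Let $$\Psi_0:\mathbf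 C\{\rho^\vee\cap M\}[U_1,\dots,U_g]\to R,\qquad U_j\mapsto q_{j-1}(\zeta),$$ be the homomorphism of $\mathbf C\{\rho^\vee\cap M\}$-algebras which defines the embedding of $S$ in the toric variety $Z_\Delta$ of the cone $\Delta=\rho\oplus\mathbf R^g_{\ge0}$. Then $\Psi_0$ is surjective, and the ideal $\operatorname{Ker}\Psi_0$ of the embedding $S\subset Z_\Delta$ is generated by $g$ elements $$H_j=U_j^{n_j}-X^{\alpha^{(j)}}U_1^{l^{(j)}_1}\cdots U_{j-1}^{l^{(j)}_{j-1}}+c_j^*U_{j+1}+r_j(U_1,\dots,U_j),\qquad j=1,\dots,g,$$ of $\mathbf C\{\rho^\vee\cap M\}[U_1,\dots,U_g]$ (without the term $c_j^*U_{j+1}$ for $j=g$), where: - $\alpha^{(j)}\in\rho^\vee\cap M$, $0\le l^{(j)}_i<n_i$ and $n_j\gamma_j=\alpha^{(j)}+l^{(j)}_1\gamma_1+\dots+l^{(j)}_{j-1}\gamma_{j-1}$; - $c_j^*\in\mathbf C^*$ for $j=1,\dots,g$; - $r_j$ has degree $<n_i$ in $U_i$ for $1\le i\le j$, and every term of $r_j$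 has weight $>_\rho n_j\gamma_j$; - the terms of $r_j$ are those of the expansion in terms of semi-roots $$q_{j-1}^{n_j}=X^{\alpha^{(j)}}q_0^{l^{(j)}_1}\cdots q_{j-2}^{l^{(j)}_{j-1}}-c_j^*q_j-r_j(q_0,\dots,q_{j-1})\quad\text{in }\mathbf C\{\rho^\vee\cap M\}[Y].$$ Thus $H_j$ is a deformation of the binomial $h_j=U_j^{n_j}-X^{\alpha^{(j)}}U_1^{l^{(j)}_1}\cdots U_{j-1}^{l^{(j)}_{j-1}}$, which is homogeneous of weight $n_j\gamma_j$: every term of $H_j-h_j$ has weight $>_\rho n_j\gamma_j$. -/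

import Mathlib

open Polynomial

noncomputable section

namespace ToricQO

/-- A rational convex polyhedral cone `ρ` in `N_ℝ = ℝ^d`, for the lattice `N = ℤ^d`, which is
strictly convex and of dimension `d` (the latter means that the dual cone is strictly convex). -/
structure RationalCone (d : ℕ) where
  cone : PointedCone ℝ (Fin d → ℝ)
  rational : ∃ s : Finset (Fin d → ℤ),
    cone = PointedCone.hull ℝ ((fun a : Fin d → ℤ => fun i => (a i : ℝ)) '' (s : Set (Fin d → ℤ)))
  strictlyConvex : ∀ w ∈ cone, -w ∈ cone → w = 0
  fullDimensional : Submodule.span ℝ (cone : Set (Fin d → ℝ)) = ⊤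

/-- The real vector space `M_ℝ = ℝ^d` dual to `N_ℝ`, where the exponents of the series live.
The cone is recorded in the type because it determines the order on the exponents. -/
def Expo {d : ℕ} (_ρ : RationalCone d) : Type := Fin d → ℝ

variable {d : ℕ} {ρ : RationalCone d}

instance : AddCommGroup (Expo ρ) := inferInstanceAs (AddCommGroup (Fin d → ℝ))

/-- The duality pairing `⟨u, w⟩` of `u ∈ M_ℝ` and `w ∈ N_ℝ`. -/
def pairing (u : Expo ρ) (w : Fin d → ℝ) : ℝ := ∑ i, u i * w i

theorem pairing_zero (w : Fin d → ℝ) : pairing (0 : Expo ρ) w = 0 :=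
  Finset.sum_eq_zero fun i _ => zero_mul (w i)

theorem pairing_add (u v : Expo ρ) (w : Fin d → ℝ) :
    pairing (u + v) w = pairing u w + pairing v w := by
  unfold pairing
  rw [← Finset.sum_add_distrib]
  exact Finset.sum_congr rfl fun i _ => add_mul (u i) (v i) (w i)

theorem pairing_sub (u v : Expo ρ) (w : Fin d → ℝ) :
    pairing (u - v) w = pairing u w - pairing v w := by
  have h := pairing_add (u - v) v w
  rw [sub_add_cancel] at h
  linarith

theorem pairing_add_right (u : Expo ρ) (w w' : Fin d → ℝ) :
    pairing u (w + w') = pairing u w + pairing u w' := by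
  unfold pairing
  rw [← Finset.sum_add_distrib]
  exact Finset.sum_congr rfl fun i _ => mul_add (u i) (w i) (w' i)

theorem eq_zero_of_pairing (u : Expo ρ) (h : ∀ w ∈ ρ.cone, pairing u w = 0) : u = 0 := by
  let L : (Fin d → ℝ) →ₗ[ℝ] ℝ :=
    { toFun := fun w => pairing u w
      map_add' := pairing_add_right u
      map_smul' := fun c w => by
        simp only [pairing, Pi.smul_apply, smul_eq_mul, RingHom.id_apply, Finset.mul_sum]
        exact Finset.sum_congr rfl fun i _ => by ring }
  have hL : (⊤ : Submodule ℝ (Fin d → ℝ)) ≤ LinearMap.ker L := by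
    rw [← ρ.fullDimensional, Submodule.span_le]
    exact fun w hw => h w hw
  funext i
  have hi : L (Pi.single i 1) = 0 := hL (Submodule.mem_top)
  have hs : L (Pi.single i 1) = u i := by
    change ∑ k, u k * (Pi.single i 1 : Fin d → ℝ) k = u i
    rw [Finset.sum_eq_single i (fun k _ hk => by simp [hk]) (fun h => absurd (Finset.mem_univ i) h)]
    simp
  exact hs.symm.trans hi

/-- The dual cone `ρ^∨ = {u ∈ M_ℝ : ⟨u, w⟩ ≥ 0 for all w ∈ ρ}`. -/
def dualCone (ρ : RationalCone d) : AddSubmonoid (Expo ρ) where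
  carrier := {u | ∀ w ∈ ρ.cone, 0 ≤ pairing u w}
  zero_mem' := fun w _ => (pairing_zero w).ge
  add_mem' := fun {u v} hu hv w hw => by
    rw [pairing_add]
    exact add_nonneg (hu w hw) (hv w hw)

/-- The partial order `u ≤_ρ u' ↔ u' ∈ u + ρ^∨`. -/
instance : PartialOrder (Expo ρ) where
  le u v := v - u ∈ dualCone ρ
  le_refl u := by
    rw [sub_self]
    exact (dualCone ρ).zero_mem
  le_trans u v w huv hvw := by
    have h := (dualCone ρ).add_mem hvw huv
    rwa [sub_add_sub_cancel] at h
  le_antisymm u v huv hvu := by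
    refine (sub_eq_zero.mp (eq_zero_of_pairing (v - u) fun w hw => ?_)).symm
    have h1 := huv w hw
    have h2 := hvu w hw
    rw [pairing_sub] at h1 h2 ⊢
    linarith

instance : IsOrderedAddMonoid (Expo ρ) where
  add_le_add_left u v huv w := by
    change v + w - (u + w) ∈ dualCone ρ
    rw [add_sub_add_right_eq_sub]
    exact huv

/-- The lattice `(1/m) M` in `M_ℝ`, where `M = ℤ^d` (used for `m ≥ 1` only). -/
def fracLattice (ρ : RationalCone d) (m : ℕ) : AddSubgroup (Expo ρ) where
  carrier := {u | ∀ i, ∃ k : ℤ, (m : ℝ) * u i = k}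
  zero_mem' := fun i => ⟨0, by
    change (m : ℝ) * 0 = _
    simp⟩
  add_mem' := fun {u v} hu hv i => by
    obtain ⟨k, hk⟩ := hu i
    obtain ⟨l, hl⟩ := hv i
    refine ⟨k + l, ?_⟩
    change (m : ℝ) * (u i + v i) = _
    push_cast
    rw [mul_add, hk, hl]
  neg_mem' := fun {u} hu i => by
    obtain ⟨k, hk⟩ := hu i
    refine ⟨-k, ?_⟩
    change (m : ℝ) * (-(u i)) = _
    push_cast
    rw [mul_neg, hk]

/-- The lattice `M = ℤ^d`. -/
def latticeM (ρ : RationalCone d) : AddSubgroup (Expo ρ) := fracLattice ρ 1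

/-- The semigroup `ρ^∨ ∩ Λ` of a lattice `Λ`. -/
def semigroup (ρ : RationalCone d) (Λ : AddSubgroup (Expo ρ)) : AddSubmonoid (Expo ρ) :=
  dualCone ρ ⊓ Λ.toAddSubmonoid

/-- The ambient ring of formal series `∑ c_u X^u` with complex coefficients and exponents in `M_ℝ`
(supports partially well ordered for `≤_ρ`; if `Λ` is a lattice `(1/m) M` then every subset of
`ρ^∨ ∩ Λ` is so). -/
abbrev Series (ρ : RationalCone d) : Type := HahnSeries (Expo ρ) ℂ

/-- `∑ |c_u| e^{-⟨u, w⟩} < ∞`. -/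
def ConvergesAt (x : Series ρ) (w : Fin d → ℝ) : Prop :=
  Summable fun u : Expo ρ => ‖x.coeff u‖ * Real.exp (-pairing u w)

theorem ConvergesAt.add_right {x : Series ρ} {w w' : Fin d → ℝ}
    (hx : ∀ u ∈ x.support, u ∈ dualCone ρ) (h : ConvergesAt x w) (hw' : w' ∈ ρ.cone) :
    ConvergesAt x (w + w') := by
  refine Summable.of_nonneg_of_le (fun u => by positivity) (fun u => ?_) h
  by_cases hu : x.coeff u = 0
  · simp [hu]
  · have h1 : 0 ≤ pairing u w' := hx u hu w' hw'
    rw [pairing_add_right]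
    gcongr
    linarith

theorem ConvergesAt.add {x y : Series ρ} {w : Fin d → ℝ}
    (hx : ConvergesAt x w) (hy : ConvergesAt y w) : ConvergesAt (x + y) w := by
  refine Summable.of_nonneg_of_le (fun u => by positivity) (fun u => ?_) (Summable.add hx hy)
  rw [HahnSeries.coeff_add, ← add_mul]
  gcongr
  exact norm_add_le _ _

theorem ConvergesAt.mul {x y : Series ρ} {w : Fin d → ℝ}
    (hx : ConvergesAt x w) (hy : ConvergesAt y w) : ConvergesAt (x * y) w := by
  classical
  have hxy := Summable.mul_of_nonneg hx hy (fun u => by positivity) (fun u => by positivity)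
  refine summable_of_sum_le (fun u => by positivity)
    (c := ∑' p : Expo ρ × Expo ρ, ‖x.coeff p.1‖ * Real.exp (-pairing p.1 w) *
      (‖y.coeff p.2‖ * Real.exp (-pairing p.2 w))) fun s => ?_
  refine le_trans ?_ (hxy.sum_le_tsum
    (s.biUnion fun a => Finset.antidiagonal x.isPWO_support y.isPWO_support a)
    (fun p _ => by positivity))
  rw [Finset.sum_biUnion]
  · refine Finset.sum_le_sum fun a _ => ?_
    rw [HahnSeries.coeff_mul]
    refine le_trans (mul_le_mul_of_nonneg_right (norm_sum_le _ _) (Real.exp_pos _).le) ?_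
    rw [Finset.sum_mul]
    refine Finset.sum_le_sum fun p hp => le_of_eq ?_
    have hp' : p.1 + p.2 = a := (Finset.mem_antidiagonal.mp hp).2.2
    rw [← hp', pairing_add, norm_mul, neg_add, Real.exp_add]
    ring
  · intro a _ b _ hab
    refine Finset.disjoint_left.mpr fun p hp hq => hab ?_
    rw [← (Finset.mem_antidiagonal.mp hp).2.2, ← (Finset.mem_antidiagonal.mp hq).2.2]

theorem convergesAt_single (u : Expo ρ) (c : ℂ) (w : Fin d → ℝ) :
    ConvergesAt (HahnSeries.single u c : Series ρ) w := by
  refine summable_of_ne_finset_zero (s := {u}) fun v hv => ?_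
  rw [HahnSeries.coeff_single_of_ne (by simpa using hv)]
  simp

/-- The ring `ℂ{ρ^∨ ∩ Λ}`: the series with exponents in `ρ^∨ ∩ Λ` such that
`∑ |c_u| e^{-⟨u, w⟩} < ∞` for some `w ∈ ρ`, that is, such that the series converges absolutely and
uniformly on the neighbourhood `{|X^u| ≤ e^{-⟨u, w⟩} for all u ∈ ρ^∨ ∩ Λ}` of the `0`-dimensional
orbit of the affine toric variety `Spec ℂ[ρ^∨ ∩ Λ]`. -/
def convSeries (ρ : RationalCone d) (Λ : AddSubgroup (Expo ρ)) : Subalgebra ℂ (Series ρ) where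
  carrier := {x | (∀ u ∈ x.support, u ∈ semigroup ρ Λ) ∧ ∃ w ∈ ρ.cone, ConvergesAt x w}
  add_mem' := fun {x y} ⟨hx, w, hw, hxw⟩ ⟨hy, w', hw', hyw⟩ => by
    refine ⟨fun u hu => ?_, w + w', ρ.cone.add_mem hw hw',
      (hxw.add_right (fun u hu => (hx u hu).1) hw').add ?_⟩
    · rcases HahnSeries.support_add_subset _ _ hu with h | h
      · exact hx u h
      · exact hy u h
    · rw [add_comm w w']
      exact hyw.add_right (fun u hu => (hy u hu).1) hw
  mul_mem' := fun {x y} ⟨hx, w, hw, hxw⟩ ⟨hy, w', hw', hyw⟩ => by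
    refine ⟨fun u hu => ?_, w + w', ρ.cone.add_mem hw hw',
      (hxw.add_right (fun u hu => (hx u hu).1) hw').mul ?_⟩
    · obtain ⟨a, ha, b, hb, rfl⟩ := HahnSeries.support_mul_subset hu
      exact (semigroup ρ Λ).add_mem (hx a ha) (hy b hb)
    · rw [add_comm w w']
      exact hyw.add_right (fun u hu => (hy u hu).1) hw
  algebraMap_mem' := fun c => by
    refine ⟨fun u hu => ?_, 0, ρ.cone.zero_mem, convergesAt_single 0 c 0⟩
    have h : u ∈ ({0} : Set (Expo ρ)) := HahnSeries.support_single_subset hu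
    rw [Set.mem_singleton_iff.mp h]
    exact (semigroup ρ Λ).zero_mem

instance (Λ : AddSubgroup (Expo ρ)) : CommRing (convSeries ρ Λ) :=
  Subalgebra.toCommRing (convSeries ρ Λ)

instance (Λ : AddSubgroup (Expo ρ)) : Algebra (convSeries ρ Λ) (Series ρ) :=
  Subalgebra.toAlgebra (convSeries ρ Λ)

/-- The monomial `X^u` for `u ∈ ρ^∨ ∩ Λ`. -/
def toricMonomial {Λ : AddSubgroup (Expo ρ)} (u : semigroup ρ Λ) : convSeries ρ Λ :=
  ⟨HahnSeries.single (u : Expo ρ) 1, fun v hv => by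
      have h : v ∈ ({(u : Expo ρ)} : Set (Expo ρ)) := HahnSeries.support_single_subset hv
      rw [Set.mem_singleton_iff.mp h]
      exact u.2,
    0, ρ.cone.zero_mem, convergesAt_single _ _ _⟩

/-- The base ring `ℂ{ρ^∨ ∩ M}`. -/
abbrev BaseRing (ρ : RationalCone d) : Type := convSeries ρ (latticeM ρ)

/-- The fractional series: elements of `ℂ{ρ^∨ ∩ (1/m) M}` for some `m ≥ 1`. -/
def IsFractional (x : Series ρ) : Prop := ∃ m : ℕ, 0 < m ∧ x ∈ convSeries ρ (fracLattice ρ m)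

/-- `x = X^u · H` with `H` a fractional series that does not vanish at the origin `o_ρ`
(that is, `H` is a unit of some `ℂ{ρ^∨ ∩ (1/m) M}`). -/
def IsMonomialTimesUnit (x : Series ρ) (u : Expo ρ) : Prop :=
  ∃ H : Series ρ, IsFractional H ∧ H.coeff 0 ≠ 0 ∧ x = HahnSeries.single u 1 * H

/-- `p ∈ ℂ{ρ^∨ ∩ M}[Y]` is quasi-ordinary: its discriminant is `X^η · H` with
`H ∈ ℂ{ρ^∨ ∩ M}`, `H(o_ρ) ≠ 0`. -/
def IsQuasiOrdinary (p : (BaseRing ρ)[X]) : Prop :=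
  ∃ (η : semigroup ρ (latticeM ρ)) (H : BaseRing ρ),
    (H : Series ρ).coeff 0 ≠ 0 ∧ p.discr = toricMonomial η * H

/-- The roots of `p` among the fractional series. -/
def branches (p : (BaseRing ρ)[X]) : Set (Series ρ) := {z | IsFractional z ∧ aeval z p = 0}

/-- The characteristic exponents of `p`: the exponents `λ` such that `ζ - ζ' = X^λ · unit` for two
different roots of `p`. -/
def charExponents (p : (BaseRing ρ)[X]) : Set (Expo ρ) :=
  {u | ∃ z ∈ branches p, ∃ z' ∈ branches p, z ≠ z' ∧ IsMonomialTimesUnit (z - z') u}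

/-- The order of coincidence of two irreducible quasi-ordinary monic polynomials is `e`.
It is `+∞` for `p = p'`; it is `u` if `p p'` is quasi-ordinary and `u` is the largest exponent of
the differences of a root of `p` and a root of `p'`. -/
def HasOrderOfCoincidence (p p' : (BaseRing ρ)[X]) : WithTop (Expo ρ) → Prop
  | ⊤ => p = p'
  | (u : Expo ρ) => IsQuasiOrdinary (p * p') ∧
      IsGreatest {v | ∃ z ∈ branches p, ∃ z' ∈ branches p', IsMonomialTimesUnit (z - z') v} u

section Characteristic

/- In this section `lam 1, …, lam g` are the characteristic exponents `λ_1 < ⋯ < λ_g`. -/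

/-- The lattice `M_k = M + ℤ λ_1 + ⋯ + ℤ λ_k`. -/
def charLattice (lam : ℕ → Expo ρ) (k : ℕ) : AddSubgroup (Expo ρ) :=
  latticeM ρ ⊔ AddSubgroup.closure (lam '' Set.Icc 1 k)

/-- The integer `n_k = # M_k / M_{k-1}` for `k ≥ 1`, and `n_0 = 1`. -/
def charInt (lam : ℕ → Expo ρ) (k : ℕ) : ℕ :=
  (charLattice lam (k - 1)).relIndex (charLattice lam k)

/-- `γ_1 = λ_1` and `γ_{j+1} = n_j γ_j + λ_{j+1} - λ_j` (the value at `0` is not used). -/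
def gam (lam : ℕ → Expo ρ) : ℕ → Expo ρ
  | 0 => 0
  | 1 => lam 1
  | (j + 2) => charInt lam (j + 1) • gam lam (j + 1) + lam (j + 2) - lam (j + 1)

/-- `f` is an irreducible quasi-ordinary monic polynomial with `f(o_ρ, Y) = Y^{deg f}`, with root
`ζ ∈ ℂ{ρ^∨ ∩ (1/n) M}`, `n = deg f`, and `λ_1 < ⋯ < λ_g` are its characteristic exponents. -/
structure IsBranch (f : (BaseRing ρ)[X]) (ζ : Series ρ) (g : ℕ) (lam : ℕ → Expo ρ) : Prop where
  monic : f.Monic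
  irreducible : Irreducible f
  quasiOrdinary : IsQuasiOrdinary f
  at_origin : ∀ i < f.natDegree, ((f.coeff i : BaseRing ρ) : Series ρ).coeff 0 = 0
  mem : ζ ∈ convSeries ρ (fracLattice ρ f.natDegree)
  root : aeval ζ f = 0
  strictMono : StrictMonoOn lam (Set.Icc 1 g)
  charExponents_eq : lam '' Set.Icc 1 g = charExponents f

/-- `p` is a (monic) `j`-th semi-root of `f`: an irreducible quasi-ordinary polynomial of degree
`n_0 ⋯ n_j` which has order of coincidence `λ_{j+1}` with `f`, where `λ_{g+1} = +∞`. -/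
structure IsSemiRoot (f : (BaseRing ρ)[X]) (g : ℕ) (lam : ℕ → Expo ρ) (j : ℕ)
    (p : (BaseRing ρ)[X]) : Prop where
  monic : p.Monic
  irreducible : Irreducible p
  quasiOrdinary : IsQuasiOrdinary p
  natDegree_eq : p.natDegree = ∏ k ∈ Finset.range (j + 1), charInt lam k
  coincidence : HasOrderOfCoincidence p f
    (if j + 1 ≤ g then ((lam (j + 1) : Expo ρ) : WithTop (Expo ρ)) else ⊤)

/-- `q_0, …, q_g` is a complete set of semi-roots of `f`, where `q_j`, for `j < g`, is multiplied
by a constant so that the coefficient of `X^{γ_{j+1}}` in `q_j(ζ)` is equal to one. -/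
structure IsNormalizedSemiRoots (f : (BaseRing ρ)[X]) (ζ : Series ρ) (g : ℕ) (lam : ℕ → Expo ρ)
    (q : Fin (g + 1) → (BaseRing ρ)[X]) : Prop where
  semiRoot : ∀ j : Fin (g + 1), ∃ (a : ℂ) (p : (BaseRing ρ)[X]),
    a ≠ 0 ∧ IsSemiRoot f g lam j p ∧ q j = Polynomial.C (algebraMap ℂ (BaseRing ρ) a) * p
  normalized : ∀ j : Fin g, (aeval ζ (q j.castSucc) : Series ρ).coeff (gam lam (j + 1)) = 1

end Characteristic

/-- The analytic algebra `R = ℂ{ρ^∨ ∩ M}[ζ]`. -/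
abbrev branchAlgebra (ζ : Series ρ) : Subalgebra (BaseRing ρ) (Series ρ) :=
  Algebra.adjoin (BaseRing ρ) {ζ}

instance (ζ : Series ρ) : CommRing (branchAlgebra ζ) :=
  Subalgebra.toCommRing (branchAlgebra ζ)

instance (ζ : Series ρ) : Algebra (BaseRing ρ) (branchAlgebra ζ) :=
  Subalgebra.algebra (branchAlgebra ζ)

/-- The homomorphism `Ψ_0 : ℂ{ρ^∨ ∩ M}[U_1, …, U_g] → R`, `U_j ↦ q_{j-1}(ζ)`. The variable `U_j` is
`MvPolynomial.X` at the index `j - 1` of `Fin g`. -/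
def embeddingHom (ζ : Series ρ) {g : ℕ} (q : Fin (g + 1) → (BaseRing ρ)[X]) :
    MvPolynomial (Fin g) (BaseRing ρ) →ₐ[BaseRing ρ] branchAlgebra ζ :=
  MvPolynomial.aeval fun j : Fin g =>
    ⟨aeval ζ (q j.castSucc), Polynomial.aeval_mem_adjoin_singleton _ _⟩

/-- The weight `α + v_1 γ_1 + ⋯ + v_g γ_g` of the monomial `X^α U^v`. -/
def weight (lam : ℕ → Expo ρ) {g : ℕ} (α : Expo ρ) (v : Fin g →₀ ℕ) : Expo ρ :=
  α + ∑ i : Fin g, v i • gam lam (i + 1)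

/-- Every term `X^α U^v` of `P` has weight `>_ρ w`. -/
def TermsWeightGT (lam : ℕ → Expo ρ) {g : ℕ} (P : MvPolynomial (Fin g) (BaseRing ρ))
    (w : Expo ρ) : Prop :=
  ∀ (v : Fin g →₀ ℕ) (α : Expo ρ), ((P.coeff v : BaseRing ρ) : Series ρ).coeff α ≠ 0 →
    w < weight lam α v

/-- The binomial `U_{j}^{n_{j}} - X^{α} U^{l}` (index shifted by one). -/
def binom (lam : ℕ → Expo ρ) {g : ℕ} (j : Fin g) (α : semigroup ρ (latticeM ρ))
    (l : Fin g →₀ ℕ) : MvPolynomial (Fin g) (BaseRing ρ) :=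
  MvPolynomial.X j ^ charInt lam (j + 1) - MvPolynomial.monomial l (toricMonomial α)

/-- The term `c U_{j+1}`, which is absent for `j = g` (index shifted by one). -/
def linearTerm {g : ℕ} (j : Fin g) (c : ℂ) : MvPolynomial (Fin g) (BaseRing ρ) :=
  if h : (j : ℕ) + 1 < g then
    MvPolynomial.C (algebraMap ℂ (BaseRing ρ) c) * MvPolynomial.X ⟨j + 1, h⟩
  else 0

end ToricQO

end

/-!
The lattice `N` acts on the fractional series by `X^u ↦ e^{2πi⟨u, ν⟩} X^u`, and the roots of an
irreducible quasi-ordinary polynomial form one orbit. For a root of the `j`-th semi-root `q_j` which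
agrees with `ζ` up to `X^{λ_{j+1}}`, the stabilizer is the lattice `M_j^⊥`: it fixes
`X^{λ_1}, …, X^{λ_j}`, and by duality its index is `n_1 ⋯ n_j`. This determines how many roots `z`
of `q_j` have `ζ - z` with a given least exponent, and the product of these differences gives
`q_j(ζ)` the least exponent `γ_{j+1}`.

Successive euclidean divisions expand a polynomial in the `q_i` with exponents `< n_{i+1}`. As
`γ_i` has order `n_i` modulo `M_{i-1}`, different terms of the expansion have different weights.
Hence, for a lexicographic order which refines `≤_ρ`, the leading exponent of the value at `ζ` is
the least weight of a term. Let `c` be such that the top coefficients of `q_{j-1}^{n_j} + c q_j`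
cancel. The value at `ζ` has the least exponent `n_j γ_j` for `≤_ρ`; so one term of the expansion
has this weight, and the others have larger weights for all the lexicographic orders, which together
determine `≤_ρ`. This is the relation `H_j`.

Modulo the `H_j` the variables `U_2, …, U_g` are polynomials in `U_1`, hence in the class of `Y`,
and the only relation left is the one given by `q_g`, which is a multiple of `f`.
-/

noncomputable section

namespace ToricQO

variable {d : ℕ} {ρ : RationalCone d}

theorem coeff_add_of_forall_mem_support_lt {Γ R : Type*} [PartialOrder Γ] [AddMonoid R]
    {x y : HahnSeries Γ R} {a : Γ} (hy : ∀ b ∈ y.support, a < b) :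
    (x + y).coeff a = x.coeff a := by
  have hya : y.coeff a = 0 := by
    by_contra h
    exact (hy a h).false
  rw [HahnSeries.coeff_add, hya, add_zero]

theorem isLeast_support_add_of_forall_mem_support_lt {Γ R : Type*} [PartialOrder Γ] [AddMonoid R]
    {x y : HahnSeries Γ R} {a : Γ} (ha : IsLeast x.support a) (hy : ∀ b ∈ y.support, a < b) :
    IsLeast (x + y).support a := by
  refine ⟨?_, fun u hu => ?_⟩
  · rw [HahnSeries.mem_support, coeff_add_of_forall_mem_support_lt hy]
    exact ha.1
  · exact (HahnSeries.support_add_subset _ _ hu).elim (ha.2 ·) (hy u · |>.le)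

section Leading

variable {Γ L R : Type*} [AddCommMonoid Γ] [PartialOrder Γ]
  [AddCommMonoid L] [PartialOrder L]

/-- `a` is a leading exponent of the Hahn series `x` for the order obtained by comparing the images
of exponents under `φ`. For `φ = id` it is the least exponent; for `φ` an injective homomorphism to
a linearly ordered group, every non-zero series has exactly one. -/
def IsLeading [Zero R] (φ : Γ →+o L) (x : HahnSeries Γ R) (a : Γ) : Prop :=
  a ∈ x.support ∧ ∀ u ∈ x.support, φ a ≤ φ u

theorem isLeast_support_iff_isLeading [Zero R] {x : HahnSeries Γ R} {a : Γ} :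
    IsLeast x.support a ↔ IsLeading (OrderAddMonoidHom.id Γ) x a :=
  Iff.rfl

theorem IsLeading.of_isLeast [Zero R] (φ : Γ →+o L) {x : HahnSeries Γ R} {a : Γ}
    (ha : IsLeast x.support a) : IsLeading φ x a :=
  ⟨ha.1, fun _ hu => φ.monotone' (ha.2 hu)⟩

theorem IsLeading.unique [Zero R] {φ : Γ →+o L} (hφ : Function.Injective φ) {x : HahnSeries Γ R}
    {a b : Γ} (ha : IsLeading φ x a) (hb : IsLeading φ x b) : a = b :=
  hφ (le_antisymm (ha.2 b hb.1) (hb.2 a ha.1))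

theorem exists_isLeading {L : Type*} [AddCommMonoid L] [LinearOrder L] [Zero R] (φ : Γ →+o L)
    {x : HahnSeries Γ R} (hx : x ≠ 0) : ∃ a, IsLeading φ x a := by
  have hpwo : (φ '' x.support).IsPWO := x.isPWO_support.image_of_monotone φ.monotone'
  have hne : (φ '' x.support).Nonempty := (HahnSeries.support_nonempty_iff.mpr hx).image φ
  obtain ⟨a, ha, hmin⟩ := hpwo.isWF.min_mem hne
  exact ⟨a, ha, fun u hu => hmin ▸ hpwo.isWF.min_le hne (Set.mem_image_of_mem φ hu)⟩

theorem exists_isLeading_sum {L : Type*} [AddCommMonoid L] [LinearOrder L] [AddCommMonoid R]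
    {φ : Γ →+o L} (hφ : Function.Injective φ) {ι : Type*} {s : Finset ι} (hs : s.Nonempty)
    {x : ι → HahnSeries Γ R} {a : ι → Γ} (hx : ∀ i ∈ s, IsLeading φ (x i) (a i))
    (ha : Set.InjOn a s) :
    ∃ i ∈ s, IsLeading φ (∑ k ∈ s, x k) (a i) ∧
      (∑ k ∈ s, x k).coeff (a i) = (x i).coeff (a i) ∧ ∀ k ∈ s, φ (a i) ≤ φ (a k) := by
  obtain ⟨i, hi, hmin⟩ := s.exists_min_image (fun k => φ (a k)) hs
  have hcoeff : (∑ k ∈ s, x k).coeff (a i) = (x i).coeff (a i) := by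
    rw [HahnSeries.coeff_sum]
    refine Finset.sum_eq_single_of_mem i hi fun k hk hki => ?_
    by_contra hne
    exact hki (ha hk hi (hφ (((hx k hk).2 _ hne).antisymm (hmin k hk))))
  refine ⟨i, hi, ⟨?_, fun u hu => ?_⟩, hcoeff, hmin⟩
  · rw [HahnSeries.mem_support, hcoeff]
    exact (hx i hi).1
  · rw [HahnSeries.mem_support, HahnSeries.coeff_sum] at hu
    obtain ⟨k, hk, hku⟩ := Finset.exists_ne_zero_of_sum_ne_zero hu
    exact (hmin k hk).trans ((hx k hk).2 u hku)

section Mul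

variable [IsOrderedCancelAddMonoid Γ] [IsOrderedCancelAddMonoid L]

theorem IsLeading.coeff_mul [NonUnitalNonAssocSemiring R] {φ : Γ →+o L}
    (hφ : Function.Injective φ) {x y : HahnSeries Γ R} {a b : Γ}
    (ha : IsLeading φ x a) (hb : IsLeading φ y b) :
    (x * y).coeff (a + b) = x.coeff a * y.coeff b := by
  classical
  rw [HahnSeries.coeff_mul]
  refine Finset.sum_eq_single_of_mem (a, b) (Finset.mem_antidiagonal.mpr ⟨ha.1, hb.1, rfl⟩) ?_
  rintro ⟨u, v⟩ huv hne
  obtain ⟨hu, hv, h⟩ := Finset.mem_antidiagonal.mp huv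
  have hφuv : φ a + φ b = φ u + φ v := by rw [← map_add, ← map_add, h]
  obtain ⟨h₁, h₂⟩ := (add_eq_add_iff_eq_and_eq (ha.2 u hu) (hb.2 v hv)).mp hφuv
  exact absurd (Prod.ext (hφ h₁).symm (hφ h₂).symm) hne

theorem IsLeading.mul [NonUnitalNonAssocSemiring R] [NoZeroDivisors R] {φ : Γ →+o L}
    (hφ : Function.Injective φ) {x y : HahnSeries Γ R} {a b : Γ}
    (ha : IsLeading φ x a) (hb : IsLeading φ y b) : IsLeading φ (x * y) (a + b) := by
  refine ⟨?_, fun u hu => ?_⟩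
  · rw [HahnSeries.mem_support, ha.coeff_mul hφ hb]
    exact mul_ne_zero ha.1 hb.1
  · obtain ⟨s, hs, t, ht, rfl⟩ := HahnSeries.support_mul_subset hu
    simp only [map_add]
    exact add_le_add (ha.2 s hs) (hb.2 t ht)

variable [CommSemiring R] [NoZeroDivisors R] [Nontrivial R] {φ : Γ →+o L}
  (hφ : Function.Injective φ) {ι : Type*} (s : Finset ι) {x : ι → HahnSeries Γ R} {a : ι → Γ}

include hφ

theorem isLeading_prod (h : ∀ i ∈ s, IsLeading φ (x i) (a i)) :
    IsLeading φ (∏ i ∈ s, x i) (∑ i ∈ s, a i) := by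
  induction s using Finset.cons_induction with
  | empty => simp [IsLeading]
  | cons i s hi ih =>
    rw [Finset.prod_cons, Finset.sum_cons]
    exact (h i (s.mem_cons_self i)).mul hφ (ih fun k hk => h k (Finset.mem_cons_of_mem hk))

theorem coeff_prod_of_isLeading (h : ∀ i ∈ s, IsLeading φ (x i) (a i)) :
    (∏ i ∈ s, x i).coeff (∑ i ∈ s, a i) = ∏ i ∈ s, (x i).coeff (a i) := by
  induction s using Finset.cons_induction with
  | empty => simp
  | cons i s hi ih =>
    have hs : ∀ k ∈ s, IsLeading φ (x k) (a k) := fun k hk => h k (Finset.mem_cons_of_mem hk)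
    rw [Finset.prod_cons, Finset.sum_cons, Finset.prod_cons,
      (h i (s.mem_cons_self i)).coeff_mul hφ (isLeading_prod hφ s hs), ih hs]

theorem IsLeading.pow {x : HahnSeries Γ R} {a : Γ} (h : IsLeading φ x a) (n : ℕ) :
    IsLeading φ (x ^ n) (n • a) := by
  simpa using isLeading_prod hφ (Finset.range n) fun _ _ => h

theorem IsLeading.coeff_pow {x : HahnSeries Γ R} {a : Γ} (h : IsLeading φ x a) (n : ℕ) :
    (x ^ n).coeff (n • a) = x.coeff a ^ n := by
  simpa using coeff_prod_of_isLeading hφ (Finset.range n) fun _ _ => h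

end Mul

end Leading

section Refinement

theorem le_iff_pairing {u v : Expo ρ} :
    u ≤ v ↔ ∀ w ∈ ρ.cone, pairing u w ≤ pairing v w := by
  refine forall₂_congr fun w _ => ?_
  rw [pairing_sub, sub_nonneg]

/-- The exponent `u` is sent to the tuple of the `⟨u, W i⟩`, compared lexicographically. -/
def lexPairing {k : ℕ} (W : Fin k → ρ.cone) : Expo ρ →+o Lex (Fin k → ℝ) where
  toFun u := toLex fun i => pairing u (W i)
  map_zero' := congrArg toLex (funext fun i => pairing_zero (W i : Fin d → ℝ))
  map_add' u v := congrArg toLex (funext fun i => pairing_add u v (W i))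
  monotone' _ _ huv := Pi.toLex_monotone fun i => le_iff_pairing.mp huv _ (W i).2

theorem exists_generators (ρ : RationalCone d) :
    ∃ (k : ℕ) (W : Fin k → ρ.cone), ∀ u : Expo ρ, (∀ i, pairing u (W i) = 0) → u = 0 := by
  obtain ⟨s, hs⟩ := ρ.rational
  have hmem : ∀ a ∈ s, (fun i => (a i : ℝ)) ∈ ρ.cone := fun a ha => by
    rw [hs]
    exact Submodule.subset_span ⟨a, ha, rfl⟩
  refine ⟨s.card, fun i => ⟨_, hmem _ (s.equivFin.symm i).2⟩,
    fun u hu => eq_zero_of_pairing u fun w hw => ?_⟩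
  rw [hs] at hw
  induction hw using Submodule.span_induction with
  | mem w hw =>
    obtain ⟨a, ha, rfl⟩ := hw
    simpa using hu (s.equivFin ⟨a, ha⟩)
  | zero => exact dotProduct_zero u
  | add v w _ _ hv hw => rw [pairing_add_right, hv, hw, add_zero]
  | smul c w _ hw =>
    have hc : pairing u (c • w) = (c : ℝ) • pairing u w := dotProduct_smul (c : ℝ) u w
    rw [hc, hw, smul_zero]

theorem exists_injective_lexPairing (ρ : RationalCone d) :
    ∃ (k : ℕ) (φ : Expo ρ →+o Lex (Fin k → ℝ)), Function.Injective φ := by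
  obtain ⟨k, W, hW⟩ := exists_generators ρ
  exact ⟨k, lexPairing W, (injective_iff_map_eq_zero _).mpr fun u hu => hW u fun i => congrFun hu i⟩

/-- A vector of the cone which separates `u` and `v`, put in front of the generators, decides the
lexicographic comparison. -/
theorem exists_injective_lt_of_not_le {u v : Expo ρ} (h : ¬ u ≤ v) :
    ∃ (k : ℕ) (φ : Expo ρ →+o Lex (Fin k → ℝ)), Function.Injective φ ∧ φ v < φ u := by
  simp only [le_iff_pairing, not_forall, not_le] at h
  obtain ⟨w, hw, hlt⟩ := h
  obtain ⟨k, W, hW⟩ := exists_generators ρ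
  refine ⟨k + 1, lexPairing (Fin.cons ⟨w, hw⟩ W), (injective_iff_map_eq_zero _).mpr fun x hx =>
    hW x fun i => ?_, 0, fun j hj => absurd hj (Fin.not_lt_zero j), hlt⟩
  exact congrFun hx i.succ

end Refinement

section LeastExponent

instance : IsDomain (Series ρ) :=
  have : NoZeroDivisors (Series ρ) := by
    obtain ⟨k, φ, hφ⟩ := exists_injective_lexPairing ρ
    refine ⟨fun {x y} hxy => ?_⟩
    by_contra! h
    obtain ⟨a, ha⟩ := exists_isLeading φ h.1
    obtain ⟨b, hb⟩ := exists_isLeading φ h.2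
    exact (ha.mul hφ hb).1 (by rw [hxy, HahnSeries.coeff_zero])
  NoZeroDivisors.to_isDomain _

theorem exists_isLeast_of_mul {x y : Series ρ} {c : Expo ρ} (h : IsLeast (x * y).support c) :
    ∃ a, IsLeast x.support a := by
  have hxy : x * y ≠ 0 := HahnSeries.support_nonempty_iff.mp ⟨c, h.1⟩
  have exists_leading {k : ℕ} {φ : Expo ρ →+o Lex (Fin k → ℝ)} (hφ : Function.Injective φ) :
      ∃ a b, IsLeading φ x a ∧ IsLeading φ y b ∧ a + b = c := by
    obtain ⟨a, ha⟩ := exists_isLeading φ (left_ne_zero_of_mul hxy)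
    obtain ⟨b, hb⟩ := exists_isLeading φ (right_ne_zero_of_mul hxy)
    exact ⟨a, b, ha, hb, (ha.mul hφ hb).unique hφ (.of_isLeast φ h)⟩
  obtain ⟨k, φ, hφ⟩ := exists_injective_lexPairing ρ
  obtain ⟨a, b, ha, hb, hab⟩ := exists_leading hφ
  refine ⟨a, ha.1, fun u hu => ?_⟩
  by_contra hau
  obtain ⟨k', ψ, hψ, hlt⟩ := exists_injective_lt_of_not_le hau
  obtain ⟨a', b', ha', hb', hab'⟩ := exists_leading hψ
  have hsum : ψ a' + ψ b' < ψ a + ψ b :=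
    add_lt_add_of_lt_of_le ((ha'.2 u hu).trans_lt hlt) (hb'.2 b hb.1)
  rw [← map_add, ← map_add, hab, hab'] at hsum
  exact hsum.false

theorem IsMonomialTimesUnit.isLeast {x : Series ρ} {u : Expo ρ} (h : IsMonomialTimesUnit x u) :
    IsLeast x.support u := by
  obtain ⟨H, ⟨m, -, hH⟩, h0, rfl⟩ := h
  have hH : IsLeast H.support 0 :=
    ⟨h0, fun v hv => show v - 0 ∈ dualCone ρ by simpa using (hH.1 v hv).1⟩
  have hu : IsLeast (HahnSeries.single u (1 : ℂ) : Series ρ).support u := by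
    rw [HahnSeries.support_single_of_ne one_ne_zero]
    exact isLeast_singleton
  simpa only [add_zero] using isLeast_support_iff_isLeading.mpr
    (IsLeading.mul (φ := .id _) Function.injective_id hu hH)

theorem isMonomialTimesUnit_of_isLeast {x : Series ρ} {u : Expo ρ} (hx : IsFractional x)
    (h : IsLeast x.support u) : IsMonomialTimesUnit x u := by
  obtain ⟨m, hm, hsupp, w, hw, hconv⟩ := hx
  have hcoeff : ∀ v, (HahnSeries.single (-u) (1 : ℂ) * x : Series ρ).coeff v = x.coeff (u + v) :=
    fun v => by simp [HahnSeries.coeff_single_mul, add_comm]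
  refine ⟨HahnSeries.single (-u) 1 * x,
    ⟨m, hm, fun v hv => ?_, w, hw, (convergesAt_single (-u) 1 w).mul hconv⟩, ?_, ?_⟩
  · rw [HahnSeries.mem_support, hcoeff] at hv
    have hdual : u + v - u ∈ dualCone ρ := h.2 hv
    have hfrac := (fracLattice ρ m).sub_mem (hsupp _ hv).2 (hsupp _ h.1).2
    rw [add_sub_cancel_left] at hdual hfrac
    exact ⟨hdual, hfrac⟩
  · rw [hcoeff, add_zero]
    exact h.1
  · rw [← mul_assoc, HahnSeries.single_mul_single]
    simp

end LeastExponent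

section Pairing

variable {G H M : Type*} [CommGroup G] [CommGroup H] [CommMonoid M]

/-- The quotient of `G` by the kernel of the pairing embeds in the dual of the quotient of `H` by
the other kernel. -/
theorem index_ker_le_index_ker_flip (hM : ∀ n ≠ 0, HasEnoughRootsOfUnity M n)
    (β : G →* H →* Mˣ) [β.flip.ker.FiniteIndex] :
    β.ker.FiniteIndex ∧ β.ker.index ≤ β.flip.ker.index := by
  let κ : G →* H ⧸ β.flip.ker →* Mˣ :=
    MonoidHom.mk' (fun a => QuotientGroup.lift _ (β a) fun b hb => DFunLike.congr_fun hb a)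
      fun a b => QuotientGroup.monoidHom_ext _ <| by
        ext x
        exact congrArg Units.val (DFunLike.congr_fun (map_mul β a b) x)
  have hker : β.ker = κ.ker := by
    ext a
    simp only [MonoidHom.mem_ker]
    refine ⟨fun h => QuotientGroup.monoidHom_ext _ h, fun h => ?_⟩
    ext x
    exact congrArg Units.val (DFunLike.congr_fun h (x : H ⧸ β.flip.ker))
  have := hM _ (Monoid.exponent_ne_zero_of_finite (G := H ⧸ β.flip.ker))
  have hcard := CommGroup.card_monoidHom_of_hasEnoughRootsOfUnity (H ⧸ β.flip.ker) M
  have : Finite (H ⧸ β.flip.ker →* Mˣ) := Nat.finite_of_card_ne_zero (hcard ▸ Nat.card_pos.ne')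
  rw [hker]
  refine ⟨inferInstance, ?_⟩
  rw [Subgroup.index_ker, Subgroup.index, ← hcard]
  exact Subgroup.card_le_card_group _

theorem index_ker_eq_index_ker_flip (hM : ∀ n ≠ 0, HasEnoughRootsOfUnity M n)
    (β : G →* H →* Mˣ) : β.ker.index = β.flip.ker.index := by
  by_cases h : β.flip.ker.FiniteIndex
  · obtain ⟨hfin, hle⟩ := index_ker_le_index_ker_flip hM β
    have : β.flip.flip.ker.FiniteIndex := hfin
    exact hle.antisymm (index_ker_le_index_ker_flip hM β.flip).2
  · have h' : ¬ β.ker.FiniteIndex := fun hfin =>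
      have : β.flip.flip.ker.FiniteIndex := hfin
      h (index_ker_le_index_ker_flip hM β.flip).1
    rw [Subgroup.finiteIndex_iff, not_not] at h h'
    rw [h, h']

end Pairing

section Twist

variable {Γ R : Type*} [AddCommMonoid Γ] [PartialOrder Γ] [IsOrderedCancelAddMonoid Γ] [CommRing R]

/-- The endomorphism of the ring of Hahn series which multiplies the monomial with exponent `u` by
`χ u`. -/
def twist (χ : AddChar Γ R) : HahnSeries Γ R →+* HahnSeries Γ R where
  toFun x := ⟨fun u => χ u * x.coeff u, x.isPWO_support.mono fun _ => right_ne_zero_of_mul⟩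
  map_one' := by
    ext u
    by_cases hu : u = 0 <;> simp [HahnSeries.coeff_one, hu]
  map_zero' := by
    ext u
    simp
  map_add' x y := by
    ext u
    simp [mul_add]
  map_mul' x y := by
    classical
    ext u
    change χ u * (x * y).coeff u = _
    trans ∑ p ∈ Finset.antidiagonal x.isPWO_support y.isPWO_support u,
      χ p.1 * x.coeff p.1 * (χ p.2 * y.coeff p.2)
    · rw [HahnSeries.coeff_mul, Finset.mul_sum]
      refine Finset.sum_congr rfl fun p hp => ?_
      rw [← (Finset.mem_antidiagonal.mp hp).2.2, χ.map_add_eq_mul, mul_mul_mul_comm]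
    · rw [HahnSeries.coeff_mul]
      refine (Finset.sum_subset ((Finset.antidiagonal_mono_left fun _ => right_ne_zero_of_mul).trans
        (Finset.antidiagonal_mono_right fun _ => right_ne_zero_of_mul)) fun p hp hn => ?_).symm
      by_contra hne
      exact hn (Finset.mem_antidiagonal.mpr ⟨left_ne_zero_of_mul hne, right_ne_zero_of_mul hne,
        (Finset.mem_antidiagonal.mp hp).2.2⟩)

theorem coeff_twist (χ : AddChar Γ R) (x : HahnSeries Γ R) (u : Γ) :
    (twist χ x).coeff u = χ u * x.coeff u :=
  rfl

end Twist

section Monodromy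

/-- The lattice `N`, written multiplicatively, in its role as fundamental group of the torus. -/
abbrev Monodromy (d : ℕ) : Type := Multiplicative (Fin d → ℤ)

/-- The character `u ↦ e^{2πi⟨u, ν⟩}` by which the loop `ν ∈ N` acts on the monomials `X^u`. -/
def monodromyChar (ν : Monodromy d) : AddChar (Expo ρ) Circle :=
  Real.fourierChar.compAddMonoidHom
    (AddMonoidHom.mk' (fun u => pairing u fun i => (ν.toAdd i : ℝ)) fun u v => pairing_add u v _)

theorem monodromyChar_apply (ν : Monodromy d) (u : Expo ρ) :
    monodromyChar ν u = Real.fourierChar (pairing u fun i => (ν.toAdd i : ℝ)) :=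
  rfl

theorem monodromyChar_mul (ν ν' : Monodromy d) (u : Expo ρ) :
    monodromyChar (ν * ν') u = monodromyChar ν u * monodromyChar ν' u := by
  rw [monodromyChar_apply, monodromyChar_apply, monodromyChar_apply, ← AddChar.map_add_eq_mul,
    ← pairing_add_right]
  congr 2 with i
  exact Int.cast_add _ _

theorem monodromyChar_one (u : Expo ρ) : monodromyChar (1 : Monodromy d) u = 1 := by
  simp [monodromyChar_apply, pairing]

instance : MulSemiringAction (Monodromy d) (Series ρ) where
  smul ν := twist (Circle.coeHom.compAddChar (monodromyChar ν))
  one_smul x := by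
    ext u
    change (monodromyChar 1 u : ℂ) * _ = _
    rw [monodromyChar_one, Circle.coe_one, one_mul]
  mul_smul ν ν' x := by
    ext u
    change (monodromyChar (ν * ν') u : ℂ) * _ = monodromyChar ν u * (monodromyChar ν' u * _)
    rw [monodromyChar_mul, Circle.coe_mul, mul_assoc]
  smul_zero ν := map_zero (twist _)
  smul_add ν := map_add (twist _)
  smul_one ν := map_one (twist _)
  smul_mul ν := map_mul (twist _)

theorem coeff_monodromy_smul (ν : Monodromy d) (x : Series ρ) (u : Expo ρ) :
    (ν • x).coeff u = monodromyChar ν u * x.coeff u :=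
  coeff_twist _ x u

theorem monodromy_smul_mem_convSeries (ν : Monodromy d) {Λ : AddSubgroup (Expo ρ)} {x : Series ρ}
    (hx : x ∈ convSeries ρ Λ) : ν • x ∈ convSeries ρ Λ := by
  obtain ⟨hsupp, w, hw, hconv⟩ := hx
  refine ⟨fun u hu => hsupp u (right_ne_zero_of_mul hu), w, hw, hconv.congr fun u => ?_⟩
  rw [coeff_monodromy_smul, norm_mul, Circle.norm_coe, one_mul]

theorem coeff_sub_monodromy_smul_ne_zero_iff {ν : Monodromy d} {x : Series ρ} {u : Expo ρ} :
    (x - ν • x).coeff u ≠ 0 ↔ x.coeff u ≠ 0 ∧ monodromyChar ν u ≠ 1 := by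
  have h : (x - ν • x).coeff u = (1 - monodromyChar ν u) * x.coeff u := by
    rw [HahnSeries.coeff_sub, coeff_monodromy_smul, sub_mul, one_mul]
  rw [h, mul_ne_zero_iff, sub_ne_zero, and_comm, ne_comm (a := (1 : ℂ)), Ne, Ne, Circle.coe_eq_one]

theorem monodromy_smul_eq_self_iff {ν : Monodromy d} {x : Series ρ} :
    ν • x = x ↔ ∀ u ∈ x.support, monodromyChar ν u = 1 := by
  rw [eq_comm, ← sub_eq_zero, HahnSeries.ext_iff, funext_iff]
  refine forall_congr' fun u => ?_
  rw [HahnSeries.coeff_zero, HahnSeries.mem_support, ← not_iff_not, ← ne_eq,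
    coeff_sub_monodromy_smul_ne_zero_iff, Classical.not_imp]

theorem mem_latticeM_iff {u : Expo ρ} :
    u ∈ latticeM ρ ↔ ∀ ν : Monodromy d, monodromyChar ν u = 1 := by
  have hchar {r : ℝ} : Real.fourierChar r = 1 ↔ ∃ k : ℤ, r = k := by
    rw [Real.fourierChar_apply', Circle.exp_eq_one]
    refine exists_congr fun k => ?_
    rw [mul_comm (k : ℝ), mul_right_inj' Real.two_pi_pos.ne']
  simp only [monodromyChar_apply, hchar]
  refine ⟨fun hu ν => ?_, fun h i => ?_⟩
  · choose k hk using hu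
    refine ⟨∑ i, k i * ν.toAdd i, ?_⟩
    simp only [pairing, Int.cast_sum, Int.cast_mul, ← hk, Nat.cast_one, one_mul]
  · obtain ⟨k, hk⟩ := h (.ofAdd (Pi.single i 1))
    refine ⟨k, ?_⟩
    rw [← hk, Nat.cast_one, one_mul]
    simp only [pairing, toAdd_ofAdd, Pi.single_apply, Int.cast_ite, Int.cast_one, Int.cast_zero,
      mul_ite, mul_one, mul_zero]
    exact (Fintype.sum_ite_eq' i u).symm

instance : SMulCommClass (Monodromy d) (BaseRing ρ) (Series ρ) where
  smul_comm ν a x := by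
    have ha : ν • (a : Series ρ) = a := monodromy_smul_eq_self_iff.mpr fun u hu =>
      mem_latticeM_iff.mp (a.2.1 u hu).2 ν
    simp only [Subalgebra.smul_def, smul_eq_mul, smul_mul', ha]

theorem mem_baseRing_of_forall_monodromy_smul_eq {x : Series ρ} {Λ : AddSubgroup (Expo ρ)}
    (hx : x ∈ convSeries ρ Λ) (h : ∀ ν : Monodromy d, ν • x = x) : x ∈ convSeries ρ (latticeM ρ) :=
  ⟨fun u hu => ⟨(hx.1 u hu).1, mem_latticeM_iff.mpr fun ν =>
    monodromy_smul_eq_self_iff.mp (h ν) u hu⟩, hx.2⟩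

/-- The sublattice `L^⊥` of the loops in `N` which act trivially on the monomials with exponents
in `L`. -/
def perp (L : AddSubgroup (Expo ρ)) : Subgroup (Monodromy d) where
  carrier := {ν | ∀ u ∈ L, monodromyChar ν u = 1}
  one_mem' u _ := monodromyChar_one u
  mul_mem' {ν ν'} hν hν' u hu := by rw [monodromyChar_mul, hν u hu, hν' u hu, one_mul]
  inv_mem' {ν} hν u hu := by
    have h := monodromyChar_mul ν ν⁻¹ u
    rw [mul_inv_cancel, monodromyChar_one, hν u hu, one_mul] at h
    exact h.symm

theorem index_perp (L : AddSubgroup (Expo ρ)) :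
    (perp L).index = (latticeM ρ).relIndex L := by
  have hM (n : ℕ) (hn : n ≠ 0) : HasEnoughRootsOfUnity Circle n :=
    have : NeZero n := ⟨hn⟩
    inferInstance
  let β : Monodromy d →* Multiplicative L →* Circleˣ :=
    MonoidHom.mk' (fun ν => toUnits.toMonoidHom.comp
      (MonoidHom.mk' (fun u => monodromyChar ν (u.toAdd : Expo ρ)) fun u v =>
        (monodromyChar ν).map_add_eq_mul _ _)) fun ν ν' => by
      ext u
      exact congrArg Circle.coeHom (monodromyChar_mul ν ν' _)
  have hker : β.ker = perp L := by
    ext ν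
    simp only [MonoidHom.mem_ker, MonoidHom.ext_iff, Units.ext_iff]
    exact ⟨fun h u hu => h (.ofAdd ⟨u, hu⟩), fun h u => h _ u.toAdd.2⟩
  have hflip : β.flip.ker = ((latticeM ρ).addSubgroupOf L).toSubgroup := by
    ext u
    simp only [MonoidHom.mem_ker, MonoidHom.ext_iff, Units.ext_iff]
    exact mem_latticeM_iff.symm
  rw [← hker, index_ker_eq_index_ker_flip hM, hflip]
  rfl

end Monodromy

section Orbit

variable {A B G : Type*} [CommRing A] [CommRing B] [Algebra A B] [Group G] [MulSemiringAction G B]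

/-- The coefficients of the product are fixed by `G`, and they lie in the subring `S`. -/
theorem exists_monic_map_eq_prod_X_sub_C (S : Subring B)
    (hS : ∀ x ∈ S, (∀ σ : G, σ • x = x) → x ∈ (algebraMap A B).range)
    {s : Finset B} (hs : ∀ z ∈ s, z ∈ S) (hstable : ∀ σ : G, ∀ z ∈ s, σ • z ∈ s) :
    ∃ p : A[X], p.Monic ∧ p.map (algebraMap A B) = ∏ z ∈ s, (X - C z) := by
  have hmonic : (∏ z ∈ s, (X - C z)).Monic := monic_prod_of_monic _ _ fun z _ => monic_X_sub_C z
  have hlifts : ∏ z ∈ s, (X - C z) ∈ lifts S.subtype :=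
    Subsemiring.prod_mem _ fun z hz => (lifts_iff_coeff_lifts _).mpr fun k => by
      rw [Subring.coe_subtype, Subtype.range_coe, coeff_sub, coeff_X, coeff_C]
      exact S.sub_mem (by split_ifs <;> simp) (by split_ifs <;> simp [hs z hz])
  have hfix (σ : G) : σ • ∏ z ∈ s, (X - C z) = ∏ z ∈ s, (X - C z) := by
    simp only [Finset.smul_prod', smul_sub, smul_X, smul_C]
    exact Finset.prod_bij (fun z _ => σ • z) (hstable σ) (fun _ _ _ _ h => smul_left_cancel σ h)
      (fun z hz => ⟨σ⁻¹ • z, hstable σ⁻¹ z hz, smul_inv_smul σ z⟩) fun _ _ => rfl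
  have hA : ∏ z ∈ s, (X - C z) ∈ lifts (algebraMap A B) :=
    (lifts_iff_coeff_lifts _).mpr fun k => hS _ (by
      simpa using (lifts_iff_coeff_lifts _).mp hlifts k) fun σ => by rw [← coeff_smul, hfix]
  obtain ⟨p, hp, -, hpm⟩ := lifts_and_natDegree_eq_and_monic hA hmonic
  exact ⟨p, hpm, hp⟩

variable [SMulCommClass G A B] {p : A[X]} {y : B}

theorem aeval_smul_eq (σ : G) (p : A[X]) (y : B) : aeval (σ • y) p = σ • aeval y p :=
  aeval_algHom_apply (MulSemiringAction.toAlgHom A B σ) y p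

theorem aeval_eq_zero_of_mem_orbit (hy : aeval y p = 0) {z : B} (hz : z ∈ MulAction.orbit G y) :
    aeval z p = 0 := by
  obtain ⟨σ, rfl⟩ := hz
  rw [aeval_smul_eq, hy, smul_zero]

variable [IsDomain B] [FaithfulSMul A B]

theorem finite_orbit (hp : p ≠ 0) (hy : aeval y p = 0) : (MulAction.orbit G y).Finite :=
  (p.rootSet_finite B).subset fun _ hz =>
    (mem_rootSet_of_injective (FaithfulSMul.algebraMap_injective A B) hp).mpr
      (aeval_eq_zero_of_mem_orbit hy hz)

theorem prod_X_sub_C_dvd_map {s : Finset B} (hs : ∀ z ∈ s, aeval z p = 0) :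
    ∏ z ∈ s, (X - C z) ∣ p.map (algebraMap A B) := by
  rcases eq_or_ne p 0 with rfl | hp
  · simp
  · have hp' : p.map (algebraMap A B) ≠ 0 :=
      (Polynomial.map_ne_zero_iff (FaithfulSMul.algebraMap_injective A B)).mpr hp
    refine (Multiset.prod_X_sub_C_dvd_iff_le_roots hp' s.1).mpr
      ((Multiset.le_iff_subset s.2).mpr fun z hz => (mem_roots hp').mpr ?_)
    rw [IsRoot, eval_map_algebraMap, hs z hz]

theorem exists_map_eq_prod_orbit (hp : p.Monic) (hirr : Irreducible p) (hy : aeval y p = 0)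
    (S : Subring B) (hS : ∀ x ∈ S, (∀ σ : G, σ • x = x) → x ∈ (algebraMap A B).range)
    (horbit : MulAction.orbit G y ⊆ S) :
    ∃ s : Finset B, (s : Set B) = MulAction.orbit G y ∧
      p.map (algebraMap A B) = ∏ z ∈ s, (X - C z) := by
  obtain ⟨s, hs⟩ := (finite_orbit (G := G) hirr.ne_zero hy).exists_finset_coe
  have hmem {z : B} : z ∈ s ↔ z ∈ MulAction.orbit G y := by rw [← hs, Finset.mem_coe]
  obtain ⟨p₀, hp₀, hmap⟩ := exists_monic_map_eq_prod_X_sub_C (A := A) S hS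
    (fun z hz => horbit (hmem.mp hz)) fun σ z hz =>
      hmem.mpr (MulAction.mem_orbit_of_mem_orbit σ (hmem.mp hz))
  have hdvd : p₀ ∣ p := by
    rw [← map_dvd_map _ (FaithfulSMul.algebraMap_injective A B) hp₀, hmap]
    exact prod_X_sub_C_dvd_map fun z hz => aeval_eq_zero_of_mem_orbit hy (hmem.mp hz)
  have hroot : aeval y p₀ = 0 := by
    rw [← eval_map_algebraMap, hmap, eval_prod]
    exact Finset.prod_eq_zero (hmem.mpr (MulAction.mem_orbit_self y)) (by simp)
  have hunit : ¬ IsUnit p₀ := fun h => by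
    rw [hp₀.isUnit_iff.mp h, map_one] at hroot
    exact one_ne_zero hroot
  refine ⟨s, hs, ?_⟩
  rw [← hmap, eq_of_monic_of_associated hp hp₀ ((hirr.dvd_iff.mp hdvd).resolve_left hunit)]

end Orbit

section Lattices

theorem relIndex_sup_zmultiples {G : Type*} [AddCommGroup G] (K : AddSubgroup G) (a : G) :
    K.relIndex (K ⊔ AddSubgroup.zmultiples a) = addOrderOf (a : G ⧸ K) := by
  rw [AddSubgroup.relIndex_sup_left]
  conv_lhs => rw [← QuotientAddGroup.ker_mk' K]
  rw [AddSubgroup.relIndex_ker, AddMonoidHom.map_zmultiples, Nat.card_zmultiples]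
  rfl

variable (lam : ℕ → Expo ρ)

theorem charLattice_zero : charLattice lam 0 = latticeM ρ := by
  simp [charLattice]

theorem charLattice_succ (k : ℕ) :
    charLattice lam (k + 1) = charLattice lam k ⊔ AddSubgroup.zmultiples (lam (k + 1)) := by
  rw [charLattice, charLattice, sup_assoc, AddSubgroup.zmultiples_eq_closure,
    ← AddSubgroup.closure_union, ← Set.image_singleton, ← Set.image_union, Set.union_singleton,
    Set.insert_Icc_right_eq_Icc_add_one (by omega)]

theorem charLattice_mono : Monotone (charLattice lam) :=
  monotone_nat_of_le_succ fun k => by rw [charLattice_succ]; exact le_sup_left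

theorem latticeM_le_charLattice (k : ℕ) : latticeM ρ ≤ charLattice lam k :=
  le_sup_left

theorem lam_mem_charLattice {i k : ℕ} (hi : 1 ≤ i) (hik : i ≤ k) : lam i ∈ charLattice lam k :=
  AddSubgroup.mem_sup_right (AddSubgroup.subset_closure ⟨i, ⟨hi, hik⟩, rfl⟩)

theorem charInt_succ (k : ℕ) :
    charInt lam (k + 1) = (charLattice lam k).relIndex (charLattice lam (k + 1)) :=
  rfl

theorem prod_charInt (j : ℕ) :
    ∏ k ∈ Finset.range (j + 1), charInt lam k = (latticeM ρ).relIndex (charLattice lam j) := by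
  induction j with
  | zero => simp [charInt, charLattice_zero]
  | succ j ih =>
    rw [Finset.prod_range_succ, ih, charInt_succ]
    exact AddSubgroup.relIndex_mul_relIndex _ _ _ (latticeM_le_charLattice lam j)
      (charLattice_mono lam j.le_succ)

theorem gam_succ_succ (j : ℕ) :
    gam lam (j + 2) = charInt lam (j + 1) • gam lam (j + 1) + (lam (j + 2) - lam (j + 1)) :=
  add_sub_assoc _ _ _

theorem gam_succ_eq_sum (j : ℕ) :
    gam lam (j + 1) = (latticeM ρ).relIndex (charLattice lam j) • lam 1 +
      ∑ i ∈ Finset.range j,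
        (charLattice lam (i + 1)).relIndex (charLattice lam j) • (lam (i + 2) - lam (i + 1)) := by
  induction j with
  | zero => simp [charLattice_zero, gam]
  | succ j ih =>
    have hmul {L : AddSubgroup (Expo ρ)} (hL : L ≤ charLattice lam j) (u : Expo ρ) :
        L.relIndex (charLattice lam (j + 1)) • u =
          charInt lam (j + 1) • L.relIndex (charLattice lam j) • u := by
      rw [smul_smul, charInt_succ, mul_comm, AddSubgroup.relIndex_mul_relIndex _ _ _ hL
        (charLattice_mono lam j.le_succ)]
    rw [gam_succ_succ, ih, Finset.sum_range_succ, AddSubgroup.relIndex_self, one_smul,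
      hmul (latticeM_le_charLattice lam j), smul_add, Finset.smul_sum, add_assoc]
    congr 2
    exact Finset.sum_congr rfl fun i hi =>
      (hmul (charLattice_mono lam (Finset.mem_range.mp hi)) _).symm

theorem gam_mem_charLattice (k : ℕ) : gam lam (k + 1) ∈ charLattice lam (k + 1) := by
  have hlam {i : ℕ} (hi : 1 ≤ i) (hik : i ≤ k + 1) := lam_mem_charLattice lam hi hik
  rw [gam_succ_eq_sum]
  refine add_mem (nsmul_mem (hlam le_rfl (by omega)) _) (sum_mem fun i hi => ?_)
  rw [Finset.mem_range] at hi
  exact nsmul_mem (sub_mem (hlam (by omega) (by omega)) (hlam (by omega) (by omega))) _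

theorem mk_gam_eq_mk_lam (k : ℕ) :
    (gam lam (k + 1) : Expo ρ ⧸ charLattice lam k) = lam (k + 1) := by
  cases k with
  | zero => rfl
  | succ k =>
    have h : -lam (k + 2) + gam lam (k + 2) =
        charInt lam (k + 1) • gam lam (k + 1) - lam (k + 1) := by
      rw [gam_succ_succ]
      abel
    refine (QuotientAddGroup.eq.mpr ?_).symm
    rw [h]
    exact sub_mem (nsmul_mem (gam_mem_charLattice lam k) _)
      (lam_mem_charLattice lam (by omega) le_rfl)

theorem charInt_succ_eq_addOrderOf (k : ℕ) :
    charInt lam (k + 1) = addOrderOf (gam lam (k + 1) : Expo ρ ⧸ charLattice lam k) := by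
  rw [charInt_succ, charLattice_succ, relIndex_sup_zmultiples, mk_gam_eq_mk_lam]

variable {lam}

theorem zsmul_gam_mem_charLattice_iff {k : ℕ} {z : ℤ} :
    z • gam lam (k + 1) ∈ charLattice lam k ↔ (charInt lam (k + 1) : ℤ) ∣ z := by
  rw [charInt_succ_eq_addOrderOf, addOrderOf_dvd_iff_zsmul_eq_zero, ← QuotientAddGroup.mk_zsmul,
    QuotientAddGroup.eq_zero_iff]

/-- The top index with a non-zero coefficient would give a multiple of `γ_i` in `M_{i-1}`. -/
theorem eq_zero_of_sum_zsmul_gam_mem {g : ℕ} {z : Fin g → ℤ}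
    (hz : ∀ i, |z i| < charInt lam (i + 1))
    (h : ∑ i, z i • gam lam (i + 1) ∈ latticeM ρ) (i : Fin g) : z i = 0 := by
  induction i using WellFoundedGT.induction with
  | ind i ih =>
    refine Int.eq_zero_of_abs_lt_dvd (zsmul_gam_mem_charLattice_iff.mp ?_) (hz i)
    rw [← Finset.add_sum_erase _ _ (Finset.mem_univ i)] at h
    refine (add_mem_cancel_right (sum_mem fun k hk => ?_)).mp (latticeM_le_charLattice lam i h)
    rcases (Finset.ne_of_mem_erase hk).lt_or_gt with hki | hik
    · exact zsmul_mem (charLattice_mono lam hki (gam_mem_charLattice lam k)) _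
    · rw [ih k hik, zero_smul]
      exact zero_mem _

theorem weight_injective {g : ℕ} {v v' : Fin g →₀ ℕ} {α α' : Expo ρ} (hα : α ∈ latticeM ρ)
    (hα' : α' ∈ latticeM ρ) (hv : ∀ i, v i < charInt lam (i + 1))
    (hv' : ∀ i, v' i < charInt lam (i + 1)) (h : weight lam α v = weight lam α' v') :
    v = v' ∧ α = α' := by
  have hz (i : Fin g) : |(v i : ℤ) - v' i| < charInt lam (i + 1) := by
    have h₁ := hv i
    have h₂ := hv' i
    rw [abs_lt]
    omega
  have hsum : ∑ i : Fin g, ((v i : ℤ) - v' i) • gam lam (i + 1) = α' - α := by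
    simp only [sub_smul, natCast_zsmul, Finset.sum_sub_distrib]
    rw [sub_eq_sub_iff_add_eq_add, add_comm]
    exact h
  obtain rfl : v = v' := by
    ext i
    have := eq_zero_of_sum_zsmul_gam_mem hz (hsum ▸ sub_mem hα' hα) i
    omega
  exact ⟨rfl, add_right_cancel h⟩

end Lattices

section Discriminant

variable {A B : Type*} [CommRing A] [CommRing B] [IsDomain B] [Algebra A B] {p : A[X]} {a b : B}

theorem sub_dvd_aeval_derivative (ha : aeval a p = 0) (hb : aeval b p = 0) (hab : a ≠ b) :
    a - b ∣ aeval a p.derivative := by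
  rw [← eval_map_algebraMap] at ha hb
  obtain ⟨Q, hQ⟩ := dvd_iff_isRoot.mpr ha
  have hQb : Q.eval b = 0 := by
    rw [hQ, eval_mul, eval_sub, eval_X, eval_C] at hb
    exact (mul_eq_zero.mp hb).resolve_left (sub_ne_zero.mpr hab.symm)
  obtain ⟨Q', rfl⟩ := dvd_iff_isRoot.mpr hQb
  refine ⟨Q'.eval a, ?_⟩
  rw [← eval_map_algebraMap, ← derivative_map, hQ]
  simp [derivative_mul]

theorem aeval_derivative_dvd_discr (hp : p.Monic) (ha : aeval a p = 0) :
    aeval a p.derivative ∣ algebraMap A B p.discr := by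
  have : Nontrivial A := (algebraMap A B).domain_nontrivial
  have hdeg : 0 < p.natDegree := hp.natDegree_pos.mpr fun h => by simp [h] at ha
  obtain ⟨s, t, -, -, hst⟩ := exists_mul_add_mul_eq_C_resultant p p.derivative le_rfl
    (natDegree_derivative_le p) (Or.inl hdeg.ne')
  rw [resultant_deriv (natDegree_pos_iff_degree_pos.mp hdeg), hp.leadingCoeff, mul_one] at hst
  have hst' := congrArg (aeval a) hst
  rw [map_add, map_mul, map_mul, ha, zero_mul, zero_add, aeval_C, map_mul, map_pow, map_neg,
    map_one] at hst'
  exact ((isUnit_one.neg).pow _).dvd_mul_left.mp ⟨_, hst'.symm⟩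

end Discriminant

section Branches

variable {p : (BaseRing ρ)[X]} {x y z : Series ρ}

theorem fracLattice_le_of_dvd {m k : ℕ} (h : m ∣ k) : fracLattice ρ m ≤ fracLattice ρ k := by
  obtain ⟨c, rfl⟩ := h
  intro u hu i
  obtain ⟨a, ha⟩ := hu i
  refine ⟨c * a, ?_⟩
  push_cast
  rw [← ha]
  ring

theorem convSeries_mono {Λ Λ' : AddSubgroup (Expo ρ)} (h : Λ ≤ Λ') :
    convSeries ρ Λ ≤ convSeries ρ Λ' :=
  fun _ hx => ⟨fun u hu => ⟨(hx.1 u hu).1, h (hx.1 u hu).2⟩, hx.2⟩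

theorem IsFractional.sub (hx : IsFractional x) (hy : IsFractional y) : IsFractional (x - y) := by
  obtain ⟨m, hm, hx⟩ := hx
  obtain ⟨k, hk, hy⟩ := hy
  exact ⟨m * k, Nat.mul_pos hm hk, sub_mem
    (convSeries_mono (fracLattice_le_of_dvd (Dvd.intro k rfl)) hx)
    (convSeries_mono (fracLattice_le_of_dvd (Dvd.intro_left m rfl)) hy)⟩

theorem isMonomialTimesUnit_sub_iff {p' : (BaseRing ρ)[X]} (hy : y ∈ branches p)
    (hz : z ∈ branches p') {u : Expo ρ} :
    IsMonomialTimesUnit (y - z) u ↔ IsLeast (y - z).support u :=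
  ⟨fun h => h.isLeast, isMonomialTimesUnit_of_isLeast (hy.1.sub hz.1)⟩

theorem smul_mem_branches (ν : Monodromy d) (hy : y ∈ branches p) : ν • y ∈ branches p := by
  obtain ⟨⟨m, hm, hmem⟩, hroot⟩ := hy
  exact ⟨⟨m, hm, monodromy_smul_mem_convSeries ν hmem⟩,
    aeval_eq_zero_of_mem_orbit hroot (MulAction.mem_orbit y ν)⟩

theorem support_monodromy_smul (ν : Monodromy d) (x : Series ρ) :
    (ν • x).support = x.support := by
  ext u
  simp [coeff_monodromy_smul]

theorem IsQuasiOrdinary.exists_isLeast_support_sub (hqo : IsQuasiOrdinary p) (hp : p.Monic)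
    (hy : aeval y p = 0) (hz : aeval z p = 0) (hyz : y ≠ z) :
    ∃ u, IsLeast (y - z).support u := by
  obtain ⟨η, H, hH, hdiscr⟩ := hqo
  have hleast : IsLeast (algebraMap (BaseRing ρ) (Series ρ) p.discr).support η :=
    IsMonomialTimesUnit.isLeast ⟨H, ⟨1, one_pos, H.2⟩, hH, by rw [hdiscr]; rfl⟩
  obtain ⟨t, ht⟩ := (sub_dvd_aeval_derivative hy hz hyz).trans (aeval_derivative_dvd_discr hp hy)
  exact exists_isLeast_of_mul (ht ▸ hleast)

variable (hp : p.Monic) (hirr : Irreducible p) (hy : y ∈ branches p)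
include hp hirr hy

theorem exists_map_eq_prod_monodromy_orbit : ∃ s : Finset (Series ρ),
    (s : Set (Series ρ)) = MulAction.orbit (Monodromy d) y ∧
      p.map (algebraMap (BaseRing ρ) (Series ρ)) = ∏ z ∈ s, (X - C z) := by
  obtain ⟨⟨m, -, hmem⟩, hroot⟩ := hy
  refine exists_map_eq_prod_orbit hp hirr hroot (convSeries ρ (fracLattice ρ m)).toSubring
    (fun x hx h => ⟨⟨x, mem_baseRing_of_forall_monodromy_smul_eq hx h⟩, rfl⟩) ?_
  rintro _ ⟨ν, rfl⟩
  exact monodromy_smul_mem_convSeries ν hmem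

theorem dvd_of_aeval_branch_eq_zero {Q : (BaseRing ρ)[X]} (hQ : aeval y Q = 0) : p ∣ Q := by
  obtain ⟨s, hs, hmap⟩ := exists_map_eq_prod_monodromy_orbit hp hirr hy
  rw [← map_dvd_map _ (FaithfulSMul.algebraMap_injective (BaseRing ρ) (Series ρ)) hp, hmap]
  refine prod_X_sub_C_dvd_map fun z hz => aeval_eq_zero_of_mem_orbit (G := Monodromy d) hQ ?_
  rw [← hs]
  exact hz

theorem branches_eq_orbit : branches p = MulAction.orbit (Monodromy d) y := by
  refine Set.Subset.antisymm (fun z hz => ?_) ?_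
  · obtain ⟨s, hs, hmap⟩ := exists_map_eq_prod_monodromy_orbit hp hirr hy
    have hz' := hz.2
    rw [← eval_map_algebraMap, hmap, eval_prod, Finset.prod_eq_zero_iff] at hz'
    obtain ⟨w, hw, hzw⟩ := hz'
    rw [eval_sub, eval_X, eval_C, sub_eq_zero] at hzw
    rwa [← hs, hzw]
  · rintro _ ⟨ν, rfl⟩
    exact smul_mem_branches ν hy

theorem natDegree_eq_index_stabilizer :
    p.natDegree = (MulAction.stabilizer (Monodromy d) y).index := by
  obtain ⟨s, hs, hmap⟩ := exists_map_eq_prod_monodromy_orbit hp hirr hy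
  rw [MulAction.index_stabilizer, ← hs, Set.ncard_coe_finset,
    ← hp.natDegree_map (algebraMap (BaseRing ρ) (Series ρ)), hmap,
    natDegree_finsetProd_X_sub_C_eq_card]

end Branches

section SubgroupOrbit

variable {G α : Type*} [Group G] [MulAction G α] {a : α} {H : Subgroup G}

theorem smul_mem_orbit_subgroup_iff (hH : MulAction.stabilizer G a ≤ H) {σ : G} :
    σ • a ∈ MulAction.orbit H a ↔ σ ∈ H := by
  refine ⟨?_, fun hσ => ⟨⟨σ, hσ⟩, rfl⟩⟩
  rintro ⟨τ, hτ : (τ : G) • a = σ • a⟩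
  have hstab : (τ : G)⁻¹ * σ ∈ MulAction.stabilizer G a := by
    rw [MulAction.mem_stabilizer_iff, mul_smul, ← hτ, inv_smul_smul]
  exact (H.mul_mem_cancel_left (H.inv_mem τ.2)).mp (hH hstab)

theorem ncard_orbit_subgroup (a : α) (H : Subgroup G) :
    (MulAction.orbit H a).ncard = (MulAction.stabilizer G a).relIndex H :=
  (MulAction.index_stabilizer H a).symm

end SubgroupOrbit

section Branch

theorem perp_anti {L L' : AddSubgroup (Expo ρ)} (h : L ≤ L') : perp L' ≤ perp L :=
  fun _ hν u hu => hν u (h hu)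

theorem relIndex_perp {L L' : AddSubgroup (Expo ρ)} (hL : latticeM ρ ≤ L) (h : L ≤ L')
    (hfin : (latticeM ρ).relIndex L' ≠ 0) : (perp L').relIndex (perp L) = L.relIndex L' := by
  rw [← AddSubgroup.relIndex_mul_relIndex _ _ _ hL h] at hfin
  have hmul := Subgroup.relIndex_mul_index (perp_anti h)
  rw [index_perp, index_perp, ← AddSubgroup.relIndex_mul_relIndex _ _ _ hL h, mul_comm] at hmul
  exact Nat.eq_of_mul_eq_mul_left (Nat.pos_of_ne_zero (left_ne_zero_of_mul hfin)) hmul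

theorem mem_perp_charLattice_iff {lam : ℕ → Expo ρ} {k : ℕ} {ν : Monodromy d} :
    ν ∈ perp (charLattice lam k) ↔ ∀ i ∈ Set.Icc 1 k, monodromyChar ν (lam i) = 1 := by
  refine ⟨fun h i hi => h _ (lam_mem_charLattice lam hi.1 hi.2), fun h => ?_⟩
  suffices charLattice lam k ≤ (monodromyChar ν).toAddMonoidHom.ker from fun u hu => this hu
  refine sup_le (fun u hu => mem_latticeM_iff.mp hu ν) ((AddSubgroup.closure_le _).mpr ?_)
  rintro _ ⟨i, hi, rfl⟩
  exact h i hi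

namespace IsBranch

variable {f : (BaseRing ρ)[X]} {ζ : Series ρ} {g : ℕ} {lam : ℕ → Expo ρ}
  (hf : IsBranch f ζ g lam)
include hf

theorem mem_branches : ζ ∈ branches f :=
  ⟨⟨f.natDegree, hf.monic.natDegree_pos_of_not_isUnit hf.irreducible.not_isUnit, hf.mem⟩, hf.root⟩

theorem exists_isLeast_sub_smul {ν : Monodromy d} (hν : ν • ζ ≠ ζ) :
    ∃ i ∈ Set.Icc 1 g, IsLeast (ζ - ν • ζ).support (lam i) := by
  have hζ := hf.mem_branches
  have hνζ := smul_mem_branches ν hζ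
  obtain ⟨u, hu⟩ := hf.quasiOrdinary.exists_isLeast_support_sub hf.monic hζ.2 hνζ.2 hν.symm
  obtain ⟨i, hi, rfl⟩ : u ∈ lam '' Set.Icc 1 g := hf.charExponents_eq ▸
    ⟨ζ, hζ, ν • ζ, hνζ, hν.symm, (isMonomialTimesUnit_sub_iff hζ hνζ).mpr hu⟩
  exact ⟨i, hi, hu⟩

theorem exists_smul_of_mem_branches {z : Series ρ} (hz : z ∈ branches f) :
    ∃ ν : Monodromy d, ν • ζ = z := by
  rwa [branches_eq_orbit hf.monic hf.irreducible hf.mem_branches] at hz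

theorem exists_isLeast_sub_smul_eq {i : ℕ} (hi : i ∈ Set.Icc 1 g) :
    ∃ ν : Monodromy d, IsLeast (ζ - ν • ζ).support (lam i) := by
  obtain ⟨z, hz, z', hz', -, h⟩ : lam i ∈ charExponents f :=
    hf.charExponents_eq ▸ Set.mem_image_of_mem lam hi
  obtain ⟨σ, rfl⟩ := hf.exists_smul_of_mem_branches hz
  obtain ⟨τ, rfl⟩ := hf.exists_smul_of_mem_branches hz'
  refine ⟨σ⁻¹ * τ, ?_⟩
  rw [← support_monodromy_smul σ, smul_sub, smul_smul, mul_inv_cancel_left]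
  exact h.isLeast

theorem coeff_lam_ne_zero {i : ℕ} (hi : i ∈ Set.Icc 1 g) : ζ.coeff (lam i) ≠ 0 := by
  obtain ⟨ν, hν⟩ := hf.exists_isLeast_sub_smul_eq hi
  exact (coeff_sub_monodromy_smul_ne_zero_iff.mp hν.1).1

theorem isLeast_sub_smul {ν : Monodromy d} {k : ℕ} (hk : k + 1 ≤ g)
    (h₀ : ν ∈ perp (charLattice lam k)) (h₁ : ν ∉ perp (charLattice lam (k + 1))) :
    IsLeast (ζ - ν • ζ).support (lam (k + 1)) := by
  have hk₁ : k + 1 ∈ Set.Icc 1 g := ⟨by omega, hk⟩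
  rw [mem_perp_charLattice_iff] at h₀ h₁
  have hchar : monodromyChar ν (lam (k + 1)) ≠ 1 := fun h => h₁ fun i hi => by
    rcases hi.2.lt_or_eq with hik | rfl
    · exact h₀ i ⟨hi.1, Nat.lt_succ_iff.mp hik⟩
    · exact h
  have hcoeff : (ζ - ν • ζ).coeff (lam (k + 1)) ≠ 0 :=
    coeff_sub_monodromy_smul_ne_zero_iff.mpr ⟨hf.coeff_lam_ne_zero hk₁, hchar⟩
  obtain ⟨i, hi, hleast⟩ := hf.exists_isLeast_sub_smul (ν := ν) fun h => hcoeff (by simp [h])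
  have hki : k < i := by
    by_contra hik
    exact (coeff_sub_monodromy_smul_ne_zero_iff.mp hleast.1).2 (h₀ i ⟨hi.1, not_lt.mp hik⟩)
  have hik : i ≤ k + 1 := (hf.strictMono.le_iff_le hi hk₁).mp (hleast.2 hcoeff)
  rwa [le_antisymm hik hki] at hleast

end IsBranch

end Branch

section SemiRoot

open scoped Classical in
/-- The least exponent of `ζ - z` for a conjugate `z` of the root `y` of a `j`-th semi-root with
`ζ - y = X^{λ_{j+1}} · unit`: it is `λ_{k+1}` if `z` and `y` are conjugate under `M_k^⊥`, with
`k ≤ j` maximal. It is written as a sum of increments so that it can be summed over `z`. -/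
def contactExponent (lam : ℕ → Expo ρ) (j : ℕ) (y z : Series ρ) : Expo ρ :=
  lam 1 + ∑ i ∈ Finset.range j,
    if z ∈ MulAction.orbit (perp (charLattice lam (i + 1))) y then lam (i + 2) - lam (i + 1) else 0

theorem contactExponent_eq {lam : ℕ → Expo ρ} {j k : ℕ} (hk : k ≤ j) {y z : Series ρ}
    (h : ∀ i ≤ j, z ∈ MulAction.orbit (perp (charLattice lam i)) y ↔ i ≤ k) :
    contactExponent lam j y z = lam (k + 1) := by
  classical
  have hsum := Finset.sum_range_sub (fun i => lam (i + 1)) k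
  rw [contactExponent, ← Finset.sum_filter, ← add_sub_cancel (lam 1) (lam (k + 1)), ← hsum]
  congr 2
  ext i
  rw [Finset.mem_filter, Finset.mem_range, Finset.mem_range]
  refine ⟨fun hi => (h _ hi.1).mp hi.2, fun hi => ⟨hi.trans_le hk, (h _ (by omega)).mpr hi⟩⟩

variable {f : (BaseRing ρ)[X]} {ζ : Series ρ} {g : ℕ} {lam : ℕ → Expo ρ}
  (hf : IsBranch f ζ g lam) {j : ℕ} (hj : j + 1 ≤ g)

include hf hj in
theorem IsSemiRoot.exists_branch {p : (BaseRing ρ)[X]} (hp : IsSemiRoot f g lam j p) :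
    ∃ y ∈ branches p, IsLeast (ζ - y).support (lam (j + 1)) := by
  have h := hp.coincidence
  rw [if_pos hj] at h
  obtain ⟨y, hy, z, hz, hyz⟩ := h.2.1
  obtain ⟨ν, rfl⟩ := hf.exists_smul_of_mem_branches hz
  refine ⟨ν⁻¹ • y, smul_mem_branches ν⁻¹ hy, ?_⟩
  rw [← support_monodromy_smul ν, smul_sub, smul_inv_smul, ← neg_sub, HahnSeries.support_neg]
  exact hyz.isLeast

variable {p : (BaseRing ρ)[X]} (hp : IsSemiRoot f g lam j p) {y : Series ρ} (hy : y ∈ branches p)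
  (hζy : IsLeast (ζ - y).support (lam (j + 1)))

include hf hj hζy in
theorem coeff_lam_ne_zero_of_coincidence {i : ℕ} (hi : i ∈ Set.Icc 1 j) :
    y.coeff (lam i) ≠ 0 := by
  have hi' : i ∈ Set.Icc 1 g := ⟨hi.1, by grind⟩
  have hlt : lam i < lam (j + 1) := hf.strictMono hi' ⟨by omega, hj⟩ (by grind)
  have hzero : (ζ - y).coeff (lam i) = 0 := by
    by_contra h
    exact hlt.not_ge (hζy.2 h)
  rw [HahnSeries.coeff_sub, sub_eq_zero] at hzero
  exact hzero ▸ hf.coeff_lam_ne_zero hi'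

include hp in
theorem IsSemiRoot.natDegree_eq_relIndex :
    p.natDegree = (latticeM ρ).relIndex (charLattice lam j) := by
  rw [hp.natDegree_eq, prod_charInt]

include hp in
theorem IsSemiRoot.relIndex_ne_zero : (latticeM ρ).relIndex (charLattice lam j) ≠ 0 := by
  rw [← hp.natDegree_eq_relIndex]
  exact (hp.monic.natDegree_pos_of_not_isUnit hp.irreducible.not_isUnit).ne'

include hf hj hp hy hζy

/-- The inclusion from left to right holds because the exponents `λ_1, …, λ_j` of `ζ` are
exponents of `y`; both sides have the index `deg p` in `N`. -/
theorem IsSemiRoot.stabilizer_eq :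
    MulAction.stabilizer (Monodromy d) y = perp (charLattice lam j) := by
  have hle : MulAction.stabilizer (Monodromy d) y ≤ perp (charLattice lam j) := fun ν hν =>
    mem_perp_charLattice_iff.mpr fun i hi => monodromy_smul_eq_self_iff.mp hν _
      (coeff_lam_ne_zero_of_coincidence hf hj hζy hi)
  have hindex :
      (MulAction.stabilizer (Monodromy d) y).index = (perp (charLattice lam j)).index := by
    rw [← natDegree_eq_index_stabilizer hp.monic hp.irreducible hy, index_perp,
      hp.natDegree_eq_relIndex]
  have hmul := Subgroup.relIndex_mul_index hle
  rw [hindex] at hmul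
  refine hle.antisymm (Subgroup.relIndex_eq_one.mp ((mul_eq_right₀ ?_).mp hmul))
  rw [index_perp]
  exact hp.relIndex_ne_zero

theorem IsSemiRoot.smul_mem_orbit_iff {i : ℕ} (hi : i ≤ j) {ν : Monodromy d} :
    ν • y ∈ MulAction.orbit (perp (charLattice lam i)) y ↔ ν ∈ perp (charLattice lam i) :=
  smul_mem_orbit_subgroup_iff ((hp.stabilizer_eq hf hj hy hζy).le.trans
    (perp_anti (charLattice_mono lam hi)))

theorem IsSemiRoot.ncard_orbit {i : ℕ} (hi : i ≤ j) :
    (MulAction.orbit (perp (charLattice lam i)) y).ncard =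
      (charLattice lam i).relIndex (charLattice lam j) := by
  rw [ncard_orbit_subgroup, hp.stabilizer_eq hf hj hy hζy,
    relIndex_perp (latticeM_le_charLattice lam i) (charLattice_mono lam hi) hp.relIndex_ne_zero]

theorem IsSemiRoot.isLeast_sub_smul (ν : Monodromy d) :
    IsLeast (ζ - ν • y).support (contactExponent lam j y (ν • y)) := by
  classical
  let P (i : ℕ) : Prop := ν ∈ perp (charLattice lam i)
  let k := Nat.findGreatest P j
  have hkj : k ≤ j := Nat.findGreatest_le j
  have hk : P k := Nat.findGreatest_spec j.zero_le (mem_perp_charLattice_iff.mpr (by simp))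
  have hiff {i : ℕ} (hi : i ≤ j) : ν ∈ perp (charLattice lam i) ↔ i ≤ k :=
    ⟨Nat.le_findGreatest (P := P) hi, fun hik => perp_anti (charLattice_mono lam hik) hk⟩
  rw [contactExponent_eq hkj fun i hi => (hp.smul_mem_orbit_iff hf hj hy hζy hi).trans (hiff hi)]
  rcases hkj.lt_or_eq with hlt | hkj
  · have hνζ : IsLeast (ζ - ν • ζ).support (lam (k + 1)) :=
      hf.isLeast_sub_smul (by omega) hk fun h => by simpa using (hiff hlt).mp h
    have hν : IsLeast (ν • (ζ - y)).support (lam (j + 1)) := by rwa [support_monodromy_smul]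
    rw [← sub_add_sub_cancel ζ (ν • ζ), ← smul_sub]
    have hlam : lam (k + 1) < lam (j + 1) :=
      hf.strictMono ⟨by omega, by omega⟩ ⟨by omega, hj⟩ (by omega)
    exact isLeast_support_add_of_forall_mem_support_lt hνζ fun u hu => hlam.trans_le (hν.2 hu)
  · have hstab : ν ∈ MulAction.stabilizer (Monodromy d) y := by
      rwa [hp.stabilizer_eq hf hj hy hζy, ← hkj]
    rwa [hkj, hstab]

theorem IsSemiRoot.sum_contactExponent {s : Finset (Series ρ)}
    (hs : (s : Set (Series ρ)) = MulAction.orbit (Monodromy d) y) :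
    ∑ z ∈ s, contactExponent lam j y z = gam lam (j + 1) := by
  classical
  have hcard : s.card = (latticeM ρ).relIndex (charLattice lam j) := by
    rw [← Set.ncard_coe_finset, hs, ← MulAction.index_stabilizer,
      ← natDegree_eq_index_stabilizer hp.monic hp.irreducible hy, hp.natDegree_eq_relIndex]
  have hfilter {i : ℕ} (hi : i ≤ j) :
      (s.filter (· ∈ MulAction.orbit (perp (charLattice lam i)) y)).card =
        (charLattice lam i).relIndex (charLattice lam j) := by
    rw [← hp.ncard_orbit hf hj hy hζy hi, ← Set.ncard_coe_finset, Finset.coe_filter]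
    congr 1
    ext z
    refine and_iff_right_of_imp ?_
    rintro ⟨ν, rfl⟩
    rw [← Finset.mem_coe, hs]
    exact ⟨ν, rfl⟩
  simp only [contactExponent, Finset.sum_add_distrib]
  rw [Finset.sum_const, Finset.sum_comm, hcard, gam_succ_eq_sum]
  congr 1
  refine Finset.sum_congr rfl fun i hi => ?_
  rw [← Finset.sum_filter, Finset.sum_const, hfilter (Finset.mem_range.mp hi)]

omit hy hζy

/-- This holds as `p(ζ)` is the product of the differences `ζ - z` over the roots `z` of `p`. -/
theorem IsSemiRoot.isLeast_support_aeval :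
    IsLeast (aeval ζ p).support (gam lam (j + 1)) := by
  obtain ⟨y, hy, hζy⟩ := hp.exists_branch hf hj
  obtain ⟨s, hs, hmap⟩ := exists_map_eq_prod_monodromy_orbit hp.monic hp.irreducible hy
  rw [← hp.sum_contactExponent hf hj hy hζy hs, ← eval_map_algebraMap, hmap, eval_prod]
  simp only [eval_sub, eval_X, eval_C]
  refine isLeading_prod (φ := .id _) Function.injective_id s fun z hz => ?_
  obtain ⟨ν, rfl⟩ : z ∈ MulAction.orbit (Monodromy d) y := hs ▸ hz
  exact hp.isLeast_sub_smul hf hj hy hζy ν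

end SemiRoot

section Expansion

variable {R : Type*} [CommRing R] [Nontrivial R]

theorem exists_eq_mul_add_of_isUnit_leadingCoeff {p : R[X]} (hp : IsUnit p.leadingCoeff) {n : ℕ}
    {F : R[X]} (hF : F.degree < ((n + 1) * p.natDegree : ℕ)) :
    ∃ A B : R[X], F = p * A + B ∧ A.degree < (n * p.natDegree : ℕ) ∧ B.degree < p.natDegree := by
  obtain ⟨a, ha⟩ := hp
  set p' := C (↑a⁻¹ : R) * p with hp'_def
  have hp' : p'.Monic := monic_C_mul_of_mul_leadingCoeff_eq_one (by rw [← ha, a.inv_mul])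
  have hdeg : p'.natDegree = p.natDegree := natDegree_C_mul_of_isUnit a⁻¹.isUnit p
  refine ⟨C (↑a⁻¹ : R) * (F /ₘ p'), F %ₘ p', ?_, ?_, ?_⟩
  · calc F = p' * (F /ₘ p') + F %ₘ p' := by rw [add_comm, modByMonic_add_div]
      _ = p * (C (↑a⁻¹ : R) * (F /ₘ p')) + F %ₘ p' := by rw [hp'_def]; ring
  · rw [← smul_eq_C_mul]
    refine (degree_smul_le _ _).trans_lt ?_
    by_cases hlt : F.degree < p'.degree
    · rw [(divByMonic_eq_zero_iff hp').mpr hlt, degree_zero]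
      exact WithBot.bot_lt_coe _
    · have hsum := degree_add_divByMonic hp' (not_lt.mp hlt)
      rw [← hsum, degree_eq_natDegree hp'.ne_zero, hdeg, add_one_mul, add_comm, Nat.cast_add] at hF
      exact lt_of_add_lt_add_right hF
  · rw [← hdeg, ← degree_eq_natDegree hp'.ne_zero]
    exact degree_modByMonic_lt F hp'

theorem exists_eq_sum_mul_pow {p : R[X]} (hp : IsUnit p.leadingCoeff) (n : ℕ) {F : R[X]}
    (hF : F.degree < (n * p.natDegree : ℕ)) :
    ∃ c : ℕ → R[X], (∀ k < n, (c k).degree < p.natDegree) ∧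
      F = ∑ k ∈ Finset.range n, c k * p ^ k := by
  induction n generalizing F with
  | zero =>
    rw [zero_mul, Nat.cast_zero, Nat.WithBot.lt_zero_iff, degree_eq_bot] at hF
    exact ⟨0, by simp, by simpa using hF⟩
  | succ n ih =>
    obtain ⟨A, B, rfl, hA, hB⟩ := exists_eq_mul_add_of_isUnit_leadingCoeff hp hF
    obtain ⟨c, hc, rfl⟩ := ih hA
    refine ⟨fun | 0 => B | k + 1 => c k, fun k hk => ?_, ?_⟩
    · cases k with
      | zero => exact hB
      | succ k => exact hc k (Nat.lt_of_succ_lt_succ hk)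
    · rw [Finset.sum_range_succ', Finset.mul_sum, pow_zero, mul_one]
      exact congrArg (· + B) (Finset.sum_congr rfl fun k _ => by ring)

/-- The exponents `v` of the monomials in the first `j` variables whose degree in the `i`-th
variable is less than `n i`, the variables being numbered from `0`. -/
def reducedExponents (g : ℕ) (n : ℕ → ℕ) (j : ℕ) : Set (Fin g →₀ ℕ) :=
  {v | ∀ i : Fin g, (i < j → v i < n i) ∧ (j ≤ i → v i = 0)}

theorem zero_mem_reducedExponents_zero (g : ℕ) (n : ℕ → ℕ) : 0 ∈ reducedExponents g n 0 :=
  fun i => ⟨fun hi => absurd hi (Nat.not_lt_zero i), fun _ => rfl⟩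

theorem add_single_mem_reducedExponents_succ {g : ℕ} {n : ℕ → ℕ} {j : Fin g} {v : Fin g →₀ ℕ}
    (hv : v ∈ reducedExponents g n j) {k : ℕ} (hk : k < n j) :
    v + Finsupp.single j k ∈ reducedExponents g n (j + 1) := by
  intro i
  rcases eq_or_ne i j with rfl | hij
  · simpa [(hv i).2 le_rfl] using hk
  · have hne : (i : ℕ) ≠ j := Fin.val_ne_of_ne hij
    rw [Finsupp.add_apply, Finsupp.single_eq_of_ne hij, add_zero]
    exact ⟨fun hi => (hv i).1 (by omega), fun hi => (hv i).2 (by omega)⟩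

theorem exists_mem_restrictSupport_aeval_eq {g : ℕ} (q : Fin g → R[X]) (n D : ℕ → ℕ)
    (hD₀ : D 0 = 1) (hD : ∀ j, D (j + 1) = n j * D j)
    (hq : ∀ i : Fin g, IsUnit (q i).leadingCoeff) (hqD : ∀ i : Fin g, (q i).natDegree = D i)
    {j : ℕ} (hj : j ≤ g) {F : R[X]} (hF : F.degree < D j) :
    ∃ P ∈ MvPolynomial.restrictSupport R (reducedExponents g n j), MvPolynomial.aeval q P = F := by
  induction j generalizing F with
  | zero =>
    rw [hD₀, Nat.cast_one, Nat.WithBot.lt_one_iff_le_zero] at hF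
    refine ⟨MvPolynomial.C (F.coeff 0), ?_, ?_⟩
    · exact (MvPolynomial.monomial_mem_restrictSupport _).mpr
        (.inl (zero_mem_reducedExponents_zero g n))
    · rw [MvPolynomial.aeval_C, algebraMap_eq, ← eq_C_of_degree_le_zero hF]
  | succ j ih =>
    let J : Fin g := ⟨j, hj⟩
    have hJ : (q J).natDegree = D j := hqD J
    rw [hD, ← hJ] at hF
    obtain ⟨c, hc, rfl⟩ := exists_eq_sum_mul_pow (hq J) (n j) hF
    have hcoeff : ∀ k : Finset.range (n j), ∃ P ∈ MvPolynomial.restrictSupport R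
        (reducedExponents g n j), MvPolynomial.aeval q P = c k := fun k =>
      ih (Nat.le_of_succ_le hj) ((hc k (Finset.mem_range.mp k.2)).trans_eq (by rw [hJ]))
    choose P hP hPc using hcoeff
    refine ⟨∑ k, P k * MvPolynomial.X J ^ (k : ℕ), sum_mem fun k _ u hu => ?_, ?_⟩
    · classical
      obtain ⟨v, hv, s, hs, rfl⟩ := Finset.mem_add.mp (MvPolynomial.support_mul _ _ hu)
      rw [MvPolynomial.support_X_pow, Finset.mem_singleton] at hs
      rw [hs]
      exact add_single_mem_reducedExponents_succ (j := J) (hP k hv) (Finset.mem_range.mp k.2)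
    · rw [map_sum, ← Finset.sum_coe_sort (Finset.range (n j)) fun k => c k * q J ^ k]
      refine Finset.sum_congr rfl fun k _ => ?_
      rw [map_mul, map_pow, MvPolynomial.aeval_X, hPc]

end Expansion

section LeadingTerm

variable {lam : ℕ → Expo ρ} {g : ℕ} {y : Fin g → Series ρ}
  (hy : ∀ i : Fin g, IsLeast (y i).support (gam lam (i + 1)))
  {P : MvPolynomial (Fin g) (BaseRing ρ)}
  (hP : ∀ v ∈ P.support, ∀ i : Fin g, v i < charInt lam (i + 1))

section Leading

variable {L : Type*} [AddCommMonoid L] [LinearOrder L] [IsOrderedCancelAddMonoid L]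
  {φ : Expo ρ →+o L} (hφ : Function.Injective φ)

include hy hφ

theorem IsLeading.mul_prod_pow {x : Series ρ} {a : Expo ρ} (hx : IsLeading φ x a)
    (v : Fin g →₀ ℕ) : IsLeading φ (x * ∏ i, y i ^ v i) (weight lam a v) :=
  hx.mul hφ (isLeading_prod hφ _ fun i _ => (IsLeading.of_isLeast φ (hy i)).pow hφ (v i))

variable (hy₁ : ∀ i : Fin g, (y i).coeff (gam lam (i + 1)) = 1)

include hy₁

theorem IsLeading.coeff_mul_prod_pow {x : Series ρ} {a : Expo ρ} (hx : IsLeading φ x a)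
    (v : Fin g →₀ ℕ) : (x * ∏ i, y i ^ v i).coeff (weight lam a v) = x.coeff a := by
  have hpow (i : Fin g) : IsLeading φ (y i ^ v i) (v i • gam lam (i + 1)) :=
    (IsLeading.of_isLeast φ (hy i)).pow hφ (v i)
  rw [weight, hx.coeff_mul hφ (isLeading_prod hφ _ fun i _ => hpow i),
    coeff_prod_of_isLeading hφ _ fun i _ => hpow i, Finset.prod_eq_one, mul_one]
  intro i _
  rw [(IsLeading.of_isLeast φ (hy i)).coeff_pow hφ, hy₁, one_pow]

include hP

theorem exists_isLeading_aeval (hP₀ : P ≠ 0) :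
    ∃ v ∈ P.support, ∃ α, IsLeading φ (MvPolynomial.aeval y P) (weight lam α v) ∧
      (MvPolynomial.aeval y P).coeff (weight lam α v) =
        ((P.coeff v : BaseRing ρ) : Series ρ).coeff α ∧
      ∀ v' α', ((P.coeff v' : BaseRing ρ) : Series ρ).coeff α' ≠ 0 →
        φ (weight lam α v) ≤ φ (weight lam α' v') := by
  have hlead : ∀ v : P.support, ∃ a, IsLeading φ ((P.coeff v : BaseRing ρ) : Series ρ) a := fun v =>
    exists_isLeading φ fun h => MvPolynomial.mem_support_iff.mp v.2 (Subtype.ext h)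
  choose a ha using hlead
  have hsum : MvPolynomial.aeval y P =
      ∑ v : P.support, ((P.coeff v : BaseRing ρ) : Series ρ) * ∏ i, y i ^ (v : Fin g →₀ ℕ) i := by
    rw [MvPolynomial.aeval_def, MvPolynomial.eval₂_eq', ← Finset.sum_coe_sort]
    rfl
  have hinj : Set.InjOn (fun v : P.support => weight lam (a v) (v : Fin g →₀ ℕ))
      (Finset.univ : Finset P.support) := fun v _ v' _ h =>
    Subtype.ext (weight_injective ((P.coeff v).2.1 _ (ha v).1).2 ((P.coeff v').2.1 _ (ha v').1).2
      (hP v v.2) (hP v' v'.2) h).1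
  obtain ⟨v₀, hv₀⟩ := MvPolynomial.support_nonempty.mpr hP₀
  obtain ⟨v, -, hv, hcoeff, hmin⟩ := exists_isLeading_sum hφ ⟨⟨v₀, hv₀⟩, Finset.mem_univ _⟩
    (fun v _ => (ha v).mul_prod_pow hy hφ v) hinj
  refine ⟨v, v.2, a v, hsum ▸ hv, ?_, fun v' α' h => ?_⟩
  · rw [hsum, hcoeff, (ha v).coeff_mul_prod_pow hy hφ hy₁]
  · have hv' : v' ∈ P.support := MvPolynomial.mem_support_iff.mpr fun h₀ => by simp [h₀] at h
    refine (hmin ⟨v', hv'⟩ (Finset.mem_univ _)).trans ?_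
    simp only [weight, map_add]
    exact add_le_add ((ha ⟨v', hv'⟩).2 α' h) le_rfl

end Leading

variable (hy₁ : ∀ i : Fin g, (y i).coeff (gam lam (i + 1)) = 1) {N : Expo ρ}
  (hN : IsLeast (MvPolynomial.aeval y P).support N)

include hy hP hy₁ hN

theorem le_weight_of_isLeast_aeval {v : Fin g →₀ ℕ} {α : Expo ρ}
    (h : ((P.coeff v : BaseRing ρ) : Series ρ).coeff α ≠ 0) : N ≤ weight lam α v := by
  by_contra hlt
  obtain ⟨k, φ, hφ, hlt⟩ := exists_injective_lt_of_not_le hlt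
  have hP₀ : P ≠ 0 := by
    rintro rfl
    simp at h
  obtain ⟨v₀, -, α₀, hlead, -, hmin⟩ := exists_isLeading_aeval hy hP hφ hy₁ hP₀
  rw [hlead.unique hφ (.of_isLeast φ hN)] at hmin
  exact (hmin v α h).not_gt hlt

theorem exists_weight_eq_of_isLeast_aeval :
    ∃ v ∈ P.support, ∃ α, weight lam α v = N ∧
      ((P.coeff v : BaseRing ρ) : Series ρ).coeff α = (MvPolynomial.aeval y P).coeff N := by
  have hP₀ : P ≠ 0 := by
    rintro rfl
    rw [map_zero] at hN
    exact hN.1 rfl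
  obtain ⟨k, φ, hφ⟩ := exists_injective_lexPairing ρ
  obtain ⟨v, hv, α, hlead, hcoeff, -⟩ := exists_isLeading_aeval hy hP hφ hy₁ hP₀
  have hw := hlead.unique hφ (.of_isLeast φ hN)
  exact ⟨v, hv, α, hw, by rw [← hcoeff, hw]⟩

theorem exists_termsWeightGT_monomial_sub (hN₁ : (MvPolynomial.aeval y P).coeff N = 1) :
    ∃ (α : semigroup ρ (latticeM ρ)) (l : Fin g →₀ ℕ), l ∈ P.support ∧
      weight lam (α : Expo ρ) l = N ∧
      TermsWeightGT lam (MvPolynomial.monomial l (toricMonomial α) - P) N := by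
  classical
  obtain ⟨l, hl, α, hw, hcoeff⟩ := exists_weight_eq_of_isLeast_aeval hy hP hy₁ hN
  rw [hN₁] at hcoeff
  have hα : α ∈ semigroup ρ (latticeM ρ) :=
    (P.coeff l).2.1 α (by rw [HahnSeries.mem_support, hcoeff]; exact one_ne_zero)
  refine ⟨⟨α, hα⟩, l, hl, hw, fun v β hβ => ?_⟩
  have hmonomial : (((MvPolynomial.monomial l (toricMonomial (⟨α, hα⟩ : semigroup ρ (latticeM ρ)))
      - P).coeff v : BaseRing ρ) : Series ρ).coeff β =
      (if l = v ∧ α = β then 1 else 0) - ((P.coeff v : BaseRing ρ) : Series ρ).coeff β := by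
    rw [MvPolynomial.coeff_sub, MvPolynomial.coeff_monomial, AddSubgroupClass.coe_sub,
      HahnSeries.coeff_sub]
    congr 1
    by_cases h : l = v <;> simp [h, toricMonomial, HahnSeries.coeff_single, eq_comm]
  rw [hmonomial] at hβ
  by_cases heq : l = v ∧ α = β
  · obtain ⟨rfl, rfl⟩ := heq
    simp [hcoeff] at hβ
  · have hPβ : ((P.coeff v : BaseRing ρ) : Series ρ).coeff β ≠ 0 := by simpa [heq] using hβ
    refine (le_weight_of_isLeast_aeval hy hP hy₁ hN hPβ).lt_of_ne fun h => heq ?_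
    exact weight_injective hα.2 ((P.coeff v).2.1 β hPβ).2 (hP l hl)
      (hP v (MvPolynomial.mem_support_iff.mpr fun h₀ => by simp [h₀] at hPβ)) (hw.trans h)

end LeadingTerm

section Expansion

variable {f : (BaseRing ρ)[X]} {ζ : Series ρ} {g : ℕ}
  {lam : ℕ → Expo ρ}

theorem aeval_C_algebraMap_mul (a : ℂ) (p : (BaseRing ρ)[X]) (z : Series ρ) :
    aeval z (C (algebraMap ℂ (BaseRing ρ) a) * p) = HahnSeries.single 0 a * aeval z p := by
  rw [map_mul, aeval_C]
  rfl

theorem coeff_aeval_C_algebraMap_mul (a : ℂ) (p : (BaseRing ρ)[X]) (z : Series ρ) (u : Expo ρ) :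
    (aeval z (C (algebraMap ℂ (BaseRing ρ) a) * p)).coeff u = a * (aeval z p).coeff u := by
  rw [aeval_C_algebraMap_mul, HahnSeries.coeff_single_zero_mul]

theorem IsBranch.charInt_nsmul_gam_lt (hf : IsBranch f ζ g lam) {j : ℕ} (hj : j + 2 ≤ g) :
    charInt lam (j + 1) • gam lam (j + 1) < gam lam (j + 2) := by
  rw [gam_succ_succ]
  exact lt_add_of_pos_right _ (sub_pos.mpr
    (hf.strictMono ⟨by omega, by omega⟩ ⟨by omega, hj⟩ (by omega)))

theorem weight_mem_charLattice_iff {j : Fin g} {α : Expo ρ} (hα : α ∈ latticeM ρ) {v : Fin g →₀ ℕ}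
    (hv : ∀ i, j < i → v i = 0) :
    weight lam α v ∈ charLattice lam j ↔ charInt lam (j + 1) ∣ v j := by
  have hrest : ∑ i ∈ Finset.univ.erase j, v i • gam lam (i + 1) ∈ charLattice lam j := by
    refine sum_mem fun i hi => ?_
    rcases (Finset.ne_of_mem_erase hi).lt_or_gt with hij | hji
    · exact nsmul_mem (charLattice_mono lam hij (gam_mem_charLattice lam i)) _
    · rw [hv i hji, zero_smul]
      exact zero_mem _
  rw [weight, add_mem_cancel_left (latticeM_le_charLattice lam j hα),
    ← Finset.add_sum_erase _ _ (Finset.mem_univ j), add_mem_cancel_right hrest, ← natCast_zsmul,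
    zsmul_gam_mem_charLattice_iff, Int.natCast_dvd_natCast]

/-- The expansion of `q_{j-1}^{n_j}` in terms of semi-roots, with leading monomial
`X^α q_0^{l_1} ⋯` and remainder `r`. -/
def IsSemiRootExpansion (lam : ℕ → Expo ρ) (q : Fin (g + 1) → (BaseRing ρ)[X]) (j : Fin g)
    (α : semigroup ρ (latticeM ρ)) (l : Fin g →₀ ℕ) (c : ℂ)
    (r : MvPolynomial (Fin g) (BaseRing ρ)) : Prop :=
  q j.castSucc ^ charInt lam (j + 1) =
    MvPolynomial.aeval (fun i : Fin g => q i.castSucc)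
        (MvPolynomial.monomial l (toricMonomial α))
      - C (algebraMap ℂ (BaseRing ρ) c) * q j.succ
      - MvPolynomial.aeval (fun i : Fin g => q i.castSucc) r

namespace IsNormalizedSemiRoots

variable {q : Fin (g + 1) → (BaseRing ρ)[X]} (hq : IsNormalizedSemiRoots f ζ g lam q)

include hq

theorem exists_last : ∃ a : ℂ, a ≠ 0 ∧ q (Fin.last g) = C (algebraMap ℂ (BaseRing ρ) a) * f := by
  obtain ⟨a, p, ha, hp, h⟩ := hq.semiRoot (Fin.last g)
  have hpf := hp.coincidence
  rw [Fin.val_last, if_neg (by omega)] at hpf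
  exact ⟨a, ha, hpf ▸ h⟩

theorem charInt_pos (i : Fin g) : 0 < charInt lam (i + 1) := by
  obtain ⟨a, p, -, hp, -⟩ := hq.semiRoot i.succ
  have hne := hp.relIndex_ne_zero
  rw [← prod_charInt, Finset.prod_ne_zero_iff] at hne
  exact Nat.pos_of_ne_zero (hne _ (by simp))

theorem isUnit_leadingCoeff_and_natDegree (i : Fin (g + 1)) : IsUnit (q i).leadingCoeff ∧
    (q i).natDegree = ∏ k ∈ Finset.range (i + 1), charInt lam k := by
  obtain ⟨a, p, ha, hp, h⟩ := hq.semiRoot i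
  have hunit : IsUnit (algebraMap ℂ (BaseRing ρ) a) := (IsUnit.mk0 a ha).map _
  rw [h, leadingCoeff_mul_monic hp.monic, leadingCoeff_C, natDegree_C_mul_of_isUnit hunit]
  exact ⟨hunit, hp.natDegree_eq⟩

theorem exists_expansion {j : ℕ} (hj : j ≤ g) {F : (BaseRing ρ)[X]}
    (hF : F.degree < (∏ k ∈ Finset.range (j + 1), charInt lam k : ℕ)) :
    ∃ P ∈ MvPolynomial.restrictSupport (BaseRing ρ)
        (reducedExponents g (fun i => charInt lam (i + 1)) j),
      MvPolynomial.aeval (fun i : Fin g => q i.castSucc) P = F :=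
  exists_mem_restrictSupport_aeval_eq _ _ (fun j => ∏ k ∈ Finset.range (j + 1), charInt lam k)
    (by simp [charInt]) (fun j => by rw [Finset.prod_range_succ, mul_comm])
    (fun i => (hq.isUnit_leadingCoeff_and_natDegree i.castSucc).1)
    (fun i => (hq.isUnit_leadingCoeff_and_natDegree i.castSucc).2) hj hF

/-- The constant makes the leading terms of `q_{j-1}^{n_j}` and `c q_j` cancel. -/
theorem exists_degree_pow_add_lt (j : Fin g) :
    ∃ c : ℂ, c ≠ 0 ∧ (q j.castSucc ^ charInt lam (j + 1) +
      C (algebraMap ℂ (BaseRing ρ) c) * q j.succ).degree <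
        (∏ k ∈ Finset.range (j + 1 + 1), charInt lam k : ℕ) := by
  obtain ⟨a, p, ha, hp, h⟩ := hq.semiRoot j.castSucc
  obtain ⟨a', p', ha', hp', h'⟩ := hq.semiRoot j.succ
  set n := charInt lam (j + 1)
  refine ⟨-(a ^ n / a'), neg_ne_zero.mpr (div_ne_zero (pow_ne_zero n ha) ha'), ?_⟩
  have hfactor : q j.castSucc ^ n + C (algebraMap ℂ (BaseRing ρ) (-(a ^ n / a'))) * q j.succ =
      algebraMap ℂ (BaseRing ρ) (a ^ n) • (p ^ n - p') := by
    rw [h, h', mul_pow, ← C_pow, ← map_pow, ← mul_assoc, ← C_mul, ← map_mul, neg_mul,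
      div_mul_cancel₀ _ ha', map_neg, C_neg, smul_eq_C_mul]
    ring
  have hdeg : (p ^ n).degree = (∏ k ∈ Finset.range (j + 1 + 1), charInt lam k : ℕ) := by
    rw [degree_eq_natDegree (hp.monic.pow n).ne_zero, hp.monic.natDegree_pow, hp.natDegree_eq,
      Finset.prod_range_succ _ ((j : ℕ) + 1), mul_comm]
    rfl
  have hdeg' : p'.degree = (∏ k ∈ Finset.range (j + 1 + 1), charInt lam k : ℕ) := by
    rw [degree_eq_natDegree hp'.monic.ne_zero, hp'.natDegree_eq]
    rfl
  rw [hfactor, ← hdeg]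
  exact (degree_smul_le _ _).trans_lt (degree_sub_lt_left (hdeg.trans hdeg'.symm)
    (hp.monic.pow n).ne_zero ((hp.monic.pow n).leadingCoeff.trans hp'.monic.leadingCoeff.symm))

variable (hf : IsBranch f ζ g lam)

include hf

theorem isLeast_support_aeval (j : Fin g) :
    IsLeast (aeval ζ (q j.castSucc)).support (gam lam (j + 1)) := by
  obtain ⟨a, p, ha, hp, h⟩ := hq.semiRoot j.castSucc
  have hsupp : (aeval ζ (q j.castSucc)).support = (aeval ζ p).support := by
    ext u
    rw [HahnSeries.mem_support, HahnSeries.mem_support, h, coeff_aeval_C_algebraMap_mul,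
      mul_ne_zero_iff_left ha]
  rw [hsupp]
  exact hp.isLeast_support_aeval hf j.2

theorem charInt_nsmul_gam_lt_of_mem_support (j : Fin g) {u : Expo ρ}
    (hu : u ∈ (aeval ζ (q j.succ)).support) : charInt lam (j + 1) • gam lam (j + 1) < u := by
  by_cases hj : (j : ℕ) + 1 < g
  · exact (hf.charInt_nsmul_gam_lt hj).trans_le ((hq.isLeast_support_aeval hf ⟨j + 1, hj⟩).2 hu)
  · have hlast : j.succ = Fin.last g := Fin.ext (by simp; omega)
    obtain ⟨a, -, ha⟩ := hq.exists_last
    rw [hlast, ha, map_mul, hf.root, mul_zero] at hu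
    exact absurd rfl hu

theorem isLeast_support_and_coeff_aeval_pow_add (j : Fin g) (c : ℂ) :
    IsLeast (aeval ζ (q j.castSucc ^ charInt lam (j + 1) +
        C (algebraMap ℂ (BaseRing ρ) c) * q j.succ)).support
      (charInt lam (j + 1) • gam lam (j + 1)) ∧
    (aeval ζ (q j.castSucc ^ charInt lam (j + 1) +
        C (algebraMap ℂ (BaseRing ρ) c) * q j.succ)).coeff
      (charInt lam (j + 1) • gam lam (j + 1)) = 1 := by
  have htail : ∀ u ∈ (aeval ζ (C (algebraMap ℂ (BaseRing ρ) c) * q j.succ)).support,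
      charInt lam (j + 1) • gam lam (j + 1) < u := fun u hu => by
    rw [HahnSeries.mem_support, coeff_aeval_C_algebraMap_mul] at hu
    exact hq.charInt_nsmul_gam_lt_of_mem_support hf j (right_ne_zero_of_mul hu)
  have hlead := isLeast_support_iff_isLeading.mp (hq.isLeast_support_aeval hf j)
  rw [map_add, map_pow, coeff_add_of_forall_mem_support_lt htail,
    hlead.coeff_pow Function.injective_id, hq.normalized, one_pow]
  exact ⟨isLeast_support_add_of_forall_mem_support_lt
    (isLeast_support_iff_isLeading.mpr (hlead.pow Function.injective_id _)) htail, rfl⟩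

/-- The leading monomial of the expansion of `q_{j-1}^{n_j} + c q_j` is free of `q_{j-1}` because
`n_j γ_j ∈ M_{j-1}`. -/
theorem exists_relation (j : Fin g) :
    ∃ (α : semigroup ρ (latticeM ρ)) (l : Fin g →₀ ℕ) (c : ℂ)
      (r : MvPolynomial (Fin g) (BaseRing ρ)),
      ((∀ i, j ≤ i → l i = 0) ∧ (∀ i, i < j → l i < charInt lam (i + 1)) ∧
        charInt lam (j + 1) • gam lam (j + 1) = weight lam (α : Expo ρ) l) ∧ c ≠ 0 ∧
      (∀ v ∈ r.support, (∀ i, j < i → v i = 0) ∧ ∀ i, i ≤ j → v i < charInt lam (i + 1)) ∧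
      TermsWeightGT lam r (charInt lam (j + 1) • gam lam (j + 1)) ∧
      IsSemiRootExpansion lam q j α l c r := by
  obtain ⟨c, hc, hdeg⟩ := hq.exists_degree_pow_add_lt j
  obtain ⟨P, hP, hPq⟩ := hq.exists_expansion j.2 hdeg
  have hred {v : Fin g →₀ ℕ} (hv : v ∈ reducedExponents g (fun i => charInt lam (i + 1)) (j + 1)) :
      (∀ i, j < i → v i = 0) ∧ ∀ i, v i < charInt lam (i + 1) := by
    refine ⟨fun i hi => (hv i).2 hi, fun i => ?_⟩
    rcases le_or_gt i j with hij | hji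
    · exact (hv i).1 (Nat.lt_succ_of_le hij)
    · exact ((hv i).2 hji).trans_lt (hq.charInt_pos i)
  have hPred : ∀ v ∈ P.support, (∀ i, j < i → v i = 0) ∧ ∀ i, v i < charInt lam (i + 1) :=
    fun v hv => hred (hP hv)
  obtain ⟨hN, hN₁⟩ := hq.isLeast_support_and_coeff_aeval_pow_add hf j c
  rw [← hPq, MvPolynomial.comp_aeval_apply] at hN hN₁
  obtain ⟨α, l, hl, hw, hgt⟩ := exists_termsWeightGT_monomial_sub (hq.isLeast_support_aeval hf)
    (fun v hv => (hPred v hv).2) hq.normalized hN hN₁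
  have hlj : l j = 0 := by
    refine Nat.eq_zero_of_dvd_of_lt ((weight_mem_charLattice_iff (lam := lam) α.2.2
      (hPred l hl).1).mp ?_) ((hPred l hl).2 j)
    rw [hw, ← natCast_zsmul, zsmul_gam_mem_charLattice_iff]
  have hr : MvPolynomial.monomial l (toricMonomial α) - P ∈ MvPolynomial.restrictSupport _ _ :=
    sub_mem ((MvPolynomial.monomial_mem_restrictSupport _).mpr (.inl (hP hl))) hP
  refine ⟨α, l, c, MvPolynomial.monomial l (toricMonomial α) - P,
    ⟨fun i hi => ?_, fun i _ => (hPred l hl).2 i, hw.symm⟩, hc,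
    fun v hv => ⟨(hred (hr hv)).1, fun i _ => (hred (hr hv)).2 i⟩, hgt, ?_⟩
  · exact hi.eq_or_lt.elim (fun h => h ▸ hlj) ((hPred l hl).1 i)
  · rw [IsSemiRootExpansion, map_sub, hPq]
    ring

end IsNormalizedSemiRoots

end Expansion

section Elimination

variable {R B : Type*} [CommRing R] [CommRing B] [Algebra R B] {g : ℕ}

variable (R g) in
/-- The variables `U_1, …, U_g`, completed by `U_{g+1} = 0` so that the linear term of `H_j` is a
multiple of `U_{j+1}` also for `j = g`. -/
def extendedVar : Fin (g + 1) → MvPolynomial (Fin g) R :=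
  Fin.snoc MvPolynomial.X 0

theorem extendedVar_last : extendedVar R g (Fin.last g) = 0 :=
  Fin.snoc_last _ _

theorem extendedVar_castSucc (i : Fin g) : extendedVar R g i.castSucc = MvPolynomial.X i :=
  Fin.snoc_castSucc _ _ _

theorem aeval_extendedVar {u : Fin (g + 1) → B} (hu : u (Fin.last g) = 0) (i : Fin (g + 1)) :
    MvPolynomial.aeval (fun i : Fin g => u i.castSucc)
      (extendedVar R g i) = u i := by
  cases i using Fin.lastCases with
  | last => rw [extendedVar_last, map_zero, hu]
  | cast i => rw [extendedVar_castSucc, MvPolynomial.aeval_X]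

variable {F : Fin g → MvPolynomial (Fin g) R} {c : Fin g → R} (hc : ∀ j, IsUnit (c j))
  (hF : ∀ j, F j ∈ MvPolynomial.supported R (Set.Iic j))

include hc hF

theorem eq_of_triangular_relations {u w : Fin (g + 1) → B}
    (hu : ∀ j, algebraMap R B (c j) * u j.succ +
      MvPolynomial.aeval (fun i : Fin g => u i.castSucc) (F j) = 0)
    (hw : ∀ j, algebraMap R B (c j) * w j.succ +
      MvPolynomial.aeval (fun i : Fin g => w i.castSucc) (F j) = 0)
    (h₀ : u 0 = w 0) : u = w := by
  funext i
  induction i using WellFoundedLT.induction with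
  | ind i ih =>
    cases i using Fin.cases with
    | zero => exact h₀
    | succ j =>
      have hFj : MvPolynomial.aeval (fun i : Fin g => u i.castSucc) (F j) =
          MvPolynomial.aeval (fun i : Fin g => w i.castSucc) (F j) :=
        MvPolynomial.eval₂Hom_congr' rfl (fun i hi _ => ih _ (Fin.castSucc_lt_succ_iff.mpr
          (MvPolynomial.mem_supported.mp (hF j) hi))) rfl
      refine ((hc j).map (algebraMap R B)).mul_left_cancel (add_right_cancel
        ((hu j).trans (hw j).symm |>.trans ?_))
      rw [hFj]

/-- Modulo the displayed ideal the classes of the `U_{j+1}` satisfy the relations of the `q_j`,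
hence are the values of the `q_j` at the class of `t`. -/
theorem mem_span_of_triangular_relations {q : Fin (g + 1) → R[X]} {t : MvPolynomial (Fin g) R}
    (hrel : ∀ j, C (c j) * q j.succ + MvPolynomial.aeval (fun i : Fin g => q i.castSucc) (F j) = 0)
    (ht : aeval t (q 0) = extendedVar R g 0) {P : MvPolynomial (Fin g) R}
    (hP : q (Fin.last g) ∣ MvPolynomial.aeval (fun i : Fin g => q i.castSucc) P) :
    P ∈ Ideal.span
      (Set.range fun j => MvPolynomial.C (c j) * extendedVar R g j.succ + F j) := by
  set I := Ideal.span (Set.range fun j => MvPolynomial.C (c j) * extendedVar R g j.succ + F j)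
  let π := Ideal.Quotient.mkₐ R I
  let w : Fin (g + 1) → MvPolynomial (Fin g) R ⧸ I := fun i => π (extendedVar R g i)
  have hw_last : w (Fin.last g) = 0 := by simp only [w, extendedVar_last, map_zero]
  have hw (Q : MvPolynomial (Fin g) R) :
      MvPolynomial.aeval (fun i : Fin g => w i.castSucc) Q = π Q := by
    simp only [w, extendedVar_castSucc]
    rw [← MvPolynomial.comp_aeval_apply, MvPolynomial.aeval_X_left_apply]
  have hqw : (fun i => aeval (π t) (q i)) = w := by
    refine eq_of_triangular_relations hc hF (fun j => ?_) (fun j => ?_) ?_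
    · rw [← MvPolynomial.comp_aeval_apply, ← aeval_C (R := R), ← map_mul, ← map_add, hrel, map_zero]
    · rw [hw]
      exact Ideal.Quotient.eq_zero_iff_mem.mpr (Ideal.subset_span ⟨j, rfl⟩)
    · rw [Polynomial.aeval_algHom_apply, ht]
  obtain ⟨Q, hQ⟩ := hP
  refine Ideal.Quotient.eq_zero_iff_mem.mp ((hw P).symm.trans ?_)
  rw [← hqw, ← MvPolynomial.comp_aeval_apply, hQ, map_mul, congrFun hqw, hw_last, zero_mul]

end Elimination

section Kernel

variable {f : (BaseRing ρ)[X]} {ζ : Series ρ} {g : ℕ}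
  {lam : ℕ → Expo ρ} {q : Fin (g + 1) → (BaseRing ρ)[X]}

theorem coe_embeddingHom (P : MvPolynomial (Fin g) (BaseRing ρ)) :
    (embeddingHom ζ q P : Series ρ) =
      MvPolynomial.aeval (fun i : Fin g => aeval ζ (q i.castSucc)) P :=
  MvPolynomial.comp_aeval_apply _ (branchAlgebra ζ).val P

theorem TermsWeightGT.add {P Q : MvPolynomial (Fin g) (BaseRing ρ)} {w : Expo ρ}
    (hP : TermsWeightGT lam P w) (hQ : TermsWeightGT lam Q w) : TermsWeightGT lam (P + Q) w := by
  intro v α h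
  by_cases hPv : ((P.coeff v : BaseRing ρ) : Series ρ).coeff α = 0
  · refine hQ v α fun hQv => h ?_
    rw [MvPolynomial.coeff_add, Subalgebra.coe_add, HahnSeries.coeff_add, hPv, hQv, add_zero]
  · exact hP v α hPv

theorem IsBranch.termsWeightGT_linearTerm (hf : IsBranch f ζ g lam) (j : Fin g) (c : ℂ) :
    TermsWeightGT lam (linearTerm (ρ := ρ) j c) (charInt lam (j + 1) • gam lam (j + 1)) := by
  classical
  intro v α h
  unfold linearTerm at h
  split_ifs at h with hj
  · rw [MvPolynomial.C_mul_X_eq_monomial, MvPolynomial.coeff_monomial] at h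
    split_ifs at h with hv
    · obtain rfl : α = 0 := by
        by_contra hα
        exact h (HahnSeries.coeff_single_of_ne hα)
      have hw : weight lam (0 : Expo ρ) v = gam lam (j + 2) := by
        simp [weight, ← hv, Finsupp.single_apply]
      rw [hw]
      exact hf.charInt_nsmul_gam_lt hj
    · exact absurd rfl h
  · exact absurd rfl h

/-- The polynomial `H_j`, the deformation of the binomial `h_j` which lies in the ideal of the
embedding. -/
def deformedBinom (lam : ℕ → Expo ρ) (j : Fin g) (α : semigroup ρ (latticeM ρ)) (l : Fin g →₀ ℕ)
    (c : ℂ) (r : MvPolynomial (Fin g) (BaseRing ρ)) : MvPolynomial (Fin g) (BaseRing ρ) :=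
  binom lam j α l + linearTerm j c + r

section Relation

variable {α : semigroup ρ (latticeM ρ)} {l : Fin g →₀ ℕ} {r : MvPolynomial (Fin g) (BaseRing ρ)}

theorem binom_add_mem_supported {j : Fin g} (hl : ∀ i, j ≤ i → l i = 0)
    (hr : ∀ v ∈ r.support, ∀ i, j < i → v i = 0) :
    binom lam j α l + r ∈ MvPolynomial.supported (BaseRing ρ) (Set.Iic j) := by
  have hmem {Q : MvPolynomial (Fin g) (BaseRing ρ)} (hQ : ∀ v ∈ Q.support, ∀ i, j < i → v i = 0) :
      Q ∈ MvPolynomial.supported (BaseRing ρ) (Set.Iic j) := by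
    refine MvPolynomial.mem_supported.mpr fun i hi => Set.mem_Iic.mpr (not_lt.mp fun hji => ?_)
    obtain ⟨v, hv, hvi⟩ := (MvPolynomial.mem_vars_iff_mem_support i).mp hi
    exact Finsupp.mem_support_iff.mp hvi (hQ v hv i hji)
  refine add_mem (sub_mem (pow_mem (hmem fun v hv i hi => ?_) _)
    (hmem fun v hv i hi => ?_)) (hmem hr)
  · rw [Finset.mem_singleton.mp (MvPolynomial.support_monomial_subset hv),
      Finsupp.single_eq_of_ne hi.ne']
  · rw [Finset.mem_singleton.mp (MvPolynomial.support_monomial_subset hv)]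
    exact hl i hi.le

theorem IsBranch.termsWeightGT_deformedBinom_sub_binom (hf : IsBranch f ζ g lam) {j : Fin g} {c : ℂ}
    (hr : TermsWeightGT lam r (charInt lam (j + 1) • gam lam (j + 1))) :
    TermsWeightGT lam (deformedBinom lam j α l c r - binom lam j α l)
      (charInt lam (j + 1) • gam lam (j + 1)) := by
  rw [deformedBinom, add_assoc, add_sub_cancel_left]
  exact (hf.termsWeightGT_linearTerm j c).add hr

theorem deformedBinom_eq (j : Fin g) (c : ℂ) :
    deformedBinom lam j α l c r =
      MvPolynomial.C (algebraMap ℂ (BaseRing ρ) c) * extendedVar (BaseRing ρ) g j.succ +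
        (binom lam j α l + r) := by
  have hlin : linearTerm j c = MvPolynomial.C (algebraMap ℂ (BaseRing ρ) c) *
      extendedVar (BaseRing ρ) g j.succ := by
    unfold linearTerm
    split_ifs with hj
    · rw [show j.succ = Fin.castSucc ⟨j + 1, hj⟩ from rfl, extendedVar_castSucc]
    · rw [show j.succ = Fin.last g from Fin.ext (by simp; omega), extendedVar_last, mul_zero]
  rw [deformedBinom, hlin]
  ring

theorem IsSemiRootExpansion.C_mul_add_aeval_eq_zero {j : Fin g} {c : ℂ}
    (hrel : IsSemiRootExpansion lam q j α l c r) :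
    C (algebraMap ℂ (BaseRing ρ) c) * q j.succ +
      MvPolynomial.aeval (fun i : Fin g => q i.castSucc) (binom lam j α l + r) = 0 := by
  unfold IsSemiRootExpansion at hrel
  rw [binom, map_add, map_sub, map_pow, MvPolynomial.aeval_X, hrel]
  ring

end Relation

namespace IsNormalizedSemiRoots

variable (hq : IsNormalizedSemiRoots f ζ g lam q)

include hq

theorem exists_coordinate (hg : 1 ≤ g) :
    ∃ t : MvPolynomial (Fin g) (BaseRing ρ),
      MvPolynomial.aeval (fun i : Fin g => q i.castSucc) t = X ∧
        aeval t (q 0) = extendedVar (BaseRing ρ) g 0 := by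
  obtain ⟨a, p, ha, hp, h⟩ := hq.semiRoot 0
  have hdeg : p.natDegree = 1 := by
    rw [hp.natDegree_eq]
    simp [charInt]
  have hq₀ : q 0 = C (algebraMap ℂ (BaseRing ρ) a) * (X + C (p.coeff 0)) := by
    rw [← hp.monic.eq_X_add_C hdeg, h]
  have haa : algebraMap ℂ (BaseRing ρ) a⁻¹ * algebraMap ℂ (BaseRing ρ) a = 1 := by
    rw [← map_mul, inv_mul_cancel₀ ha, map_one]
  refine ⟨MvPolynomial.C (algebraMap ℂ (BaseRing ρ) a⁻¹) * MvPolynomial.X ⟨0, hg⟩ -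
    MvPolynomial.C (p.coeff 0), ?_, ?_⟩
  · rw [map_sub, map_mul, MvPolynomial.aeval_X, MvPolynomial.aeval_C, MvPolynomial.aeval_C,
      show Fin.castSucc ⟨0, hg⟩ = 0 from rfl, hq₀, algebraMap_eq, ← mul_assoc, ← C_mul, haa, C_1]
    ring
  · rw [show (0 : Fin (g + 1)) = Fin.castSucc ⟨0, hg⟩ from rfl, extendedVar_castSucc,
      show Fin.castSucc ⟨0, hg⟩ = 0 from rfl, hq₀, map_mul, map_add, aeval_X, aeval_C,
      aeval_C, MvPolynomial.algebraMap_eq, sub_add_cancel, ← mul_assoc, ← map_mul,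
      mul_comm (algebraMap ℂ (BaseRing ρ) a), haa, map_one, one_mul]

theorem embeddingHom_surjective (hg : 1 ≤ g) : Function.Surjective (embeddingHom ζ q) := by
  obtain ⟨t, ht, -⟩ := hq.exists_coordinate hg
  rintro ⟨z, hz⟩
  obtain ⟨Q, rfl⟩ := (Algebra.adjoin_singleton_eq_range_aeval (BaseRing ρ) ζ).le hz
  refine ⟨aeval t Q, Subtype.ext ?_⟩
  rw [coe_embeddingHom, ← MvPolynomial.comp_aeval_apply, ← Polynomial.aeval_algHom_apply, ht,
    aeval_X_left_apply]
  rfl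

theorem aeval_last_eq_zero (hf : IsBranch f ζ g lam) : aeval ζ (q (Fin.last g)) = 0 := by
  obtain ⟨a, -, ha⟩ := hq.exists_last
  rw [ha, map_mul, hf.root, mul_zero]

theorem last_dvd_of_embeddingHom_eq_zero (hf : IsBranch f ζ g lam)
    {P : MvPolynomial (Fin g) (BaseRing ρ)} (hP : embeddingHom ζ q P = 0) :
    q (Fin.last g) ∣ MvPolynomial.aeval (fun i : Fin g => q i.castSucc) P := by
  obtain ⟨a, ha, hqa⟩ := hq.exists_last
  have hunit : IsUnit (C (algebraMap ℂ (BaseRing ρ) a)) :=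
    ((IsUnit.mk0 a ha).map (algebraMap ℂ (BaseRing ρ))).map C
  rw [hqa, hunit.mul_left_dvd]
  refine dvd_of_aeval_branch_eq_zero hf.monic hf.irreducible hf.mem_branches ?_
  rw [MvPolynomial.comp_aeval_apply, ← coe_embeddingHom, hP, Subalgebra.coe_zero]

variable {α : Fin g → semigroup ρ (latticeM ρ)} {l : Fin g → Fin g →₀ ℕ} {c : Fin g → ℂ}
  {r : Fin g → MvPolynomial (Fin g) (BaseRing ρ)}

theorem deformedBinom_mem_ker (hf : IsBranch f ζ g lam) {j : Fin g}
    (hrel : IsSemiRootExpansion lam q j (α j) (l j) (c j) (r j)) :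
    embeddingHom ζ q (deformedBinom lam j (α j) (l j) (c j) (r j)) = 0 := by
  refine Subtype.ext ?_
  rw [coe_embeddingHom, deformedBinom_eq, map_add, map_mul,
    aeval_extendedVar (u := fun i => aeval ζ (q i)) (hq.aeval_last_eq_zero hf),
    MvPolynomial.aeval_C, ← MvPolynomial.comp_aeval_apply, ← aeval_C, ← map_mul, ← map_add,
    hrel.C_mul_add_aeval_eq_zero, map_zero]
  rfl

theorem ker_embeddingHom (hg : 1 ≤ g) (hf : IsBranch f ζ g lam)
    (hrel : ∀ j, IsSemiRootExpansion lam q j (α j) (l j) (c j) (r j)) (hc : ∀ j, c j ≠ 0)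
    (hl : ∀ j i, j ≤ i → l j i = 0) (hr : ∀ j, ∀ v ∈ (r j).support, ∀ i, j < i → v i = 0) :
    RingHom.ker (embeddingHom ζ q) =
      Ideal.span (Set.range fun j => deformedBinom lam j (α j) (l j) (c j) (r j)) := by
  refine le_antisymm (fun P hP => ?_) (Ideal.span_le.mpr ?_)
  · obtain ⟨t, -, ht⟩ := hq.exists_coordinate hg
    simp only [deformedBinom_eq]
    exact mem_span_of_triangular_relations (fun j => (IsUnit.mk0 _ (hc j)).map _)
      (fun j => binom_add_mem_supported (hl j) (hr j))
      (fun j => (hrel j).C_mul_add_aeval_eq_zero) ht (hq.last_dvd_of_embeddingHom_eq_zero hf hP)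
  · rintro _ ⟨j, rfl⟩
    exact hq.deformedBinom_mem_ker hf (hrel j)

end IsNormalizedSemiRoots

end Kernel

end ToricQO

end

theorem mainTheorem9 {d : ℕ} (ρ : ToricQO.RationalCone d)
    (f : Polynomial (ToricQO.BaseRing ρ)) (ζ : ToricQO.Series ρ)
    (g : ℕ) (hg : 1 ≤ g) (lam : ℕ → ToricQO.Expo ρ)
    (hf : ToricQO.IsBranch f ζ g lam)
    (q : Fin (g + 1) → Polynomial (ToricQO.BaseRing ρ))
    (hq : ToricQO.IsNormalizedSemiRoots f ζ g lam q) :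
    Function.Surjective (ToricQO.embeddingHom ζ q) ∧
    ∃ (α : Fin g → ToricQO.semigroup ρ (ToricQO.latticeM ρ)) (l : Fin g → Fin g →₀ ℕ)
      (c : Fin g → ℂ) (r H : Fin g → MvPolynomial (Fin g) (ToricQO.BaseRing ρ)),
      -- the relations `n_j γ_j = α^(j) + l_1^(j) γ_1 + ⋯ + l_{j-1}^(j) γ_{j-1}`
      (∀ j : Fin g,
        (∀ i, j ≤ i → l j i = 0) ∧ (∀ i, i < j → l j i < ToricQO.charInt lam (i + 1)) ∧
        ToricQO.charInt lam (j + 1) • ToricQO.gam lam (j + 1) =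
          ToricQO.weight lam (α j : ToricQO.Expo ρ) (l j)) ∧
      -- the shape of the `H_j`
      (∀ j : Fin g, c j ≠ 0 ∧
        H j = ToricQO.binom lam j (α j) (l j) + ToricQO.linearTerm j (c j) + r j) ∧
      -- `r_j` is a polynomial in `U_1, …, U_j`, of degree `< n_i` in `U_i`
      (∀ j : Fin g, ∀ v ∈ (r j).support,
        (∀ i, j < i → v i = 0) ∧ (∀ i, i ≤ j → v i < ToricQO.charInt lam (i + 1))) ∧
      -- the terms of `r_j`, and those of `H_j - h_j`, have weight `> n_j γ_j`
      (∀ j : Fin g,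
        ToricQO.TermsWeightGT lam (r j)
          (ToricQO.charInt lam (j + 1) • ToricQO.gam lam (j + 1)) ∧
        ToricQO.TermsWeightGT lam (H j - ToricQO.binom lam j (α j) (l j))
          (ToricQO.charInt lam (j + 1) • ToricQO.gam lam (j + 1))) ∧
      -- the terms of `r_j` are given by the expansion of `q_{j-1}^{n_j}` in terms of semi-roots
      (∀ j : Fin g,
        q j.castSucc ^ ToricQO.charInt lam (j + 1) =
          MvPolynomial.aeval (fun i : Fin g => q i.castSucc)
              (MvPolynomial.monomial (l j) (ToricQO.toricMonomial (α j)))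
            - Polynomial.C (algebraMap ℂ (ToricQO.BaseRing ρ) (c j)) * q j.succ
            - MvPolynomial.aeval (fun i : Fin g => q i.castSucc) (r j)) ∧
      -- the ideal of the embedding is generated by the `H_j`
      RingHom.ker (ToricQO.embeddingHom ζ q) = Ideal.span (Set.range H) := by
  choose α l c r hl hc hr hw hrel using fun j => hq.exists_relation hf j
  exact ⟨hq.embeddingHom_surjective hg, α, l, c, r,
    fun j => ToricQO.deformedBinom lam j (α j) (l j) (c j) (r j), hl, fun j => ⟨hc j, rfl⟩, hr,
    fun j => ⟨hw j, hf.termsWeightGT_deformedBinom_sub_binom (hw j)⟩, hrel,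
    hq.ker_embeddingHom hg hf hrel hc (fun j => (hl j).1) fun j v hv => (hr j v hv).1⟩
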